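/- Let $\tau\in\mathbb R\setminus\{0,1,-1\}$, $v>0$, $\mu>0$, and let $$H^1_\tau=\{u\in H^1(\mathbb R_-)\oplus H^1(\mathbb R_+)\,:\,u(0+)=\tau\,u(0-)\}$$ be the space of functions $u\in L^2(\mathbb R;\mathbb C)$ whose restrictions to the half-lines $\mathbb R_-=(-\infty,0)$ and $\mathbb R_+=(0,\infty)$ belong to $H^1$ and whose one-sided limits $u(0\pm)$ at the origin (taken for the continuous representatives) satisfy $u(0+)=\tau u(0-)$. Write $\|u'\|_2^2=\|u'\|^2_{L^2(\mathbb R_-)}+\|u'\|^2_{L^2(\mathbb R_+)}$ and $\|u\|_p=\|u\|_{L^p(\mathbb R)}$, and for $\omega\in\mathbb R$ and $u\in H^1_\tau$ define the action $$S_\omega(u)=\tfrac12\|u'\|_2^2-\tfrac1{2\mu+2}\|u\|_{2\mu+2}^{2\mu+2}-\tfrac v2|u(0-)|^2+\tfrac\omega2\|u\|_2^2$$ and the Nehari functional $$I_\omega(u)=\|u'\|_2^2-\|u\|_{2\mu+2}^{2\mu+2}-v|u(0-)|^2+\omega\|u\|_2^2.$$ If $\omega>\dfrac{v^2}{(\tau^2+1)^2}$,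 then there exists $u\in H^1_\tau\setminus\{0\}$ with $I_\omega(u)=0$ such that $$S_\omega(u)\le S_\omega(w)\qquad\text{for all } w\in H^1_\tau\setminus\{0\}\text{ with } I_\omega(w)=0.$$ -/

import Mathlib

open MeasureTheory Set

noncomputable section

namespace FulopTsutsui

/-- Test functions on an open set `Ω ⊆ ℝ`: the smooth functions with compact support
contained in `Ω`. -/
def IsTestFunction (Ω : Set ℝ) (φ : ℝ → ℝ) : Prop :=
  ContDiff ℝ (⊤ : ℕ∞) φ ∧ HasCompactSupport φ ∧ tsupport φ ⊆ Ω

/-- `g` is a weak (distributional) derivative of `f` on the open set `Ω`. -/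
def HasWeakDerivOn (Ω : Set ℝ) (f g : ℝ → ℂ) : Prop :=
  LocallyIntegrableOn f Ω ∧ LocallyIntegrableOn g Ω ∧
    ∀ φ : ℝ → ℝ, IsTestFunction Ω φ →
      ∫ x in Ω, deriv φ x • f x = -∫ x in Ω, φ x • g x

/-- The Sobolev space `H¹(Ω)` of complex functions: `f` and its weak derivative are in `L²(Ω)`. -/
def MemH1 (Ω : Set ℝ) (f : ℝ → ℂ) : Prop :=
  MemLp f 2 (volume.restrict Ω) ∧
    ∃ g : ℝ → ℂ, MemLp g 2 (volume.restrict Ω) ∧ HasWeakDerivOn Ω f g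

open Classical in
/-- The weak derivative of `f` on `Ω` (unique up to null subsets of `Ω`), and `0` if there is
none. -/
def weakDeriv (Ω : Set ℝ) (f : ℝ → ℂ) : ℝ → ℂ :=
  if h : ∃ g, HasWeakDerivOn Ω f g then h.choose else 0

/-- `f` has boundary value `c` at the point `p`: some representative of `f` is continuous up to
the boundary of `Ω` and has the value `c` at `p`. -/
def HasBoundaryValue (Ω : Set ℝ) (f : ℝ → ℂ) (p : ℝ) (c : ℂ) : Prop :=
  ∃ w : ℝ → ℂ, ContinuousOn w (closure Ω) ∧ w =ᵐ[volume.restrict Ω] f ∧ w p = c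

open Classical in
/-- The boundary value of `f` at `p` from `Ω`, and `0` if there is none. -/
def boundaryValue (Ω : Set ℝ) (f : ℝ → ℂ) (p : ℝ) : ℂ :=
  if h : ∃ c, HasBoundaryValue Ω f p c then h.choose else 0

/-- `u(0-)`. -/
def leftTrace (f : ℝ → ℂ) : ℂ := boundaryValue (Iio 0) f 0

/-- `u(0+)`. -/
def rightTrace (f : ℝ → ℂ) : ℂ := boundaryValue (Ioi 0) f 0

/-- The energy space `H¹_τ = {u ∈ H¹(ℝ₋) ⊕ H¹(ℝ₊) : u(0+) = τ u(0-)}`, inside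
`L²(ℝ) = L²(ℝ₋) ⊕ L²(ℝ₊)`. -/
def H1tau (τ : ℝ) : Set (Lp ℂ 2 (volume : Measure ℝ)) :=
  {u | MemH1 (Iio 0) u ∧ MemH1 (Ioi 0) u ∧ rightTrace u = (τ : ℂ) * leftTrace u}

/-- `‖u'‖₂² = ‖u'‖²_{L²(ℝ₋)} + ‖u'‖²_{L²(ℝ₊)}`. -/
def derivNormSq (u : Lp ℂ 2 (volume : Measure ℝ)) : ℝ :=
  (∫ x in Iio 0, ‖weakDeriv (Iio 0) u x‖ ^ 2) + ∫ x in Ioi 0, ‖weakDeriv (Ioi 0) u x‖ ^ 2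

/-- `‖u‖_p^p`. -/
def powerNorm (p : ℝ) (u : Lp ℂ 2 (volume : Measure ℝ)) : ℝ :=
  ∫ x, ‖u x‖ ^ p

/-- The energy `E(u)`. -/
def energy (v μ : ℝ) (u : Lp ℂ 2 (volume : Measure ℝ)) : ℝ :=
  1 / 2 * derivNormSq u - 1 / (2 * μ + 2) * powerNorm (2 * μ + 2) u
    - v / 2 * ‖leftTrace u‖ ^ 2

/-- The action `S_ω(u)`. -/
def action (v μ ω : ℝ) (u : Lp ℂ 2 (volume : Measure ℝ)) : ℝ :=
  energy v μ u + ω / 2 * ‖u‖ ^ 2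

/-- The Nehari functional `I_ω(u)`. -/
def nehari (v μ ω : ℝ) (u : Lp ℂ 2 (volume : Measure ℝ)) : ℝ :=
  derivNormSq u - powerNorm (2 * μ + 2) u - v * ‖leftTrace u‖ ^ 2 + ω * ‖u‖ ^ 2

/-- The Nehari manifold `{u ∈ H¹_τ \ {0} : I_ω(u) = 0}`. -/
def nehariManifold (τ v μ ω : ℝ) : Set (Lp ℂ 2 (volume : Measure ℝ)) :=
  {u | u ∈ H1tau τ ∧ u ≠ 0 ∧ nehari v μ ω u = 0}

end FulopTsutsui

end

noncomputable section

open Filter Topology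

namespace FulopTsutsui

/-! The minimum is found outright: an explicit lower bound is attained by two pieces of solitons
glued at the origin, so no compactness argument is needed. Only moduli matter: a state is replaced
by profiles `(ρ, γ)` of its modulus and the modulus of its derivative on two copies of `(0, ∞)`. Up
to exchanging the half-lines, their boundary values are `x` and `κ x` with `κ ≤ 1`, and the point
interaction is `q x²`.

Let `m` be the soliton peak and `A` the primitive of `r θ(r)`. For `0 ≤ r ≤ m` the potential `ω r²/2
- r^(2μ+2)/(2μ+2)` is the square `(r θ(r))²/2`. Completing the square bounds the action of a
half-line by the variation of `A ∘ ρ` (`IsProfile.le_profileAction`): it is at least `A(ρ 0)`, and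
at least `2 A(m) - A(ρ 0)` if `ρ` reaches `m`. Solitons give equality.

On the Nehari manifold the action is maximal along rays (`action_ray_le`), so a competitor may be
bounded below after any convenient rescaling. Rescaling its maximum to `m` leaves the function
`bumpAction` of the boundary value, whose derivative has the sign of `κ² θ(κ x) - θ(x) - q`, a
nondecreasing quantity (`monotoneOn_sq_mul_theta_sub_theta`). If it vanishes at some `x` in `(0,
m]`, the minimizer has its peak inside the half-line with the larger trace. Otherwise `bumpAction`
decreases, and the minimizer consists of two monotone tails with `θ(x) + κ² θ(κ x) = q`; competitors
whose rescaled boundary value exceeds `x` are rescaled to boundary value `x` instead. The threshold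
on `ω` says `q < (1 + κ²) √ω`, which makes these equations solvable (`exists_critical`). In both
cases the critical equation, times `x²`, is the Nehari constraint for the glued solitons. -/

/-! ### Primitives of `L²` functions on the half-line. -/

theorem absolutelyContinuousOnInterval_of_dist_le {X Y : Type*} [PseudoMetricSpace X]
    [PseudoMetricSpace Y] {f : ℝ → X} {G : ℝ → Y} {K a b : ℝ}
    (hG : AbsolutelyContinuousOnInterval G a b)
    (h : ∀ x ∈ uIcc a b, ∀ y ∈ uIcc a b, dist (f x) (f y) ≤ K * dist (G x) (G y)) :
    AbsolutelyContinuousOnInterval f a b := by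
  have hK : Tendsto (fun E : ℕ × (ℕ → ℝ × ℝ) ↦
      K * ∑ i ∈ Finset.range E.1, dist (G (E.2 i).1) (G (E.2 i).2))
      (AbsolutelyContinuousOnInterval.totalLengthFilter ⊓
        𝓟 (AbsolutelyContinuousOnInterval.disjWithin a b)) (𝓝 0) := by
    simpa using Tendsto.const_mul K hG
  refine squeeze_zero' (Eventually.of_forall fun E ↦ Finset.sum_nonneg fun _ _ ↦ dist_nonneg) ?_ hK
  filter_upwards [mem_inf_of_right (mem_principal_self _)] with E hE
  rw [Finset.mul_sum]
  exact Finset.sum_le_sum fun i hi ↦ h _ (hE.1 i hi).1 _ (hE.1 i hi).2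

theorem absolutelyContinuousOnInterval_primitive {g : ℝ → ℂ} {a b : ℝ}
    (hg : IntervalIntegrable g volume a b) :
    AbsolutelyContinuousOnInterval (fun x ↦ ∫ t in a..x, g t) a b := by
  refine absolutelyContinuousOnInterval_of_dist_le (K := 1)
    (hg.norm.absolutelyContinuousOnInterval_intervalIntegral left_mem_uIcc) fun x hx y hy ↦ ?_
  have hgx : IntervalIntegrable g volume a x := hg.mono_set (uIcc_subset_uIcc_left hx)
  have hgy : IntervalIntegrable g volume a y := hg.mono_set (uIcc_subset_uIcc_left hy)
  rw [dist_eq_norm, dist_eq_norm, one_mul, intervalIntegral.integral_interval_sub_left hgx hgy,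
    intervalIntegral.integral_interval_sub_left hgx.norm hgy.norm]
  exact intervalIntegral.norm_integral_le_abs_integral_norm

/-- Integration by parts: the product minus the primitive of its formal derivative is absolutely
continuous with derivative zero almost everywhere, hence constant. -/
theorem integral_deriv_smul_primitive_add {φ : ℝ → ℝ} (hφ : ContDiff ℝ 1 φ) {g : ℝ → ℂ}
    {R : ℝ} (hg : IntervalIntegrable g volume 0 R) (c : ℂ) :
    IntervalIntegrable (fun x ↦ deriv φ x • (c + ∫ t in (0 : ℝ)..x, g t)) volume 0 R ∧
    IntervalIntegrable (fun x ↦ φ x • g x) volume 0 R ∧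
    (∫ x in (0 : ℝ)..R, deriv φ x • (c + ∫ t in (0 : ℝ)..x, g t))
      + ∫ x in (0 : ℝ)..R, φ x • g x = φ R • (c + ∫ t in (0 : ℝ)..R, g t) - φ 0 • c := by
  have hφ' : Continuous (deriv φ) := hφ.continuous_deriv le_rfl
  have hGac := absolutelyContinuousOnInterval_primitive hg
  have hc : AbsolutelyContinuousOnInterval (fun _ : ℝ ↦ c) 0 R :=
    (contDiff_const (n := 1)).contDiffOn.absolutelyContinuousOnInterval
  have hG2 : AbsolutelyContinuousOnInterval (fun x ↦ c + ∫ t in (0 : ℝ)..x, g t) 0 R :=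
    hc.fun_add hGac
  have h1 : IntervalIntegrable (fun x ↦ deriv φ x • (c + ∫ t in (0 : ℝ)..x, g t)) volume 0 R :=
    (hφ'.continuousOn.smul hG2.continuousOn).intervalIntegrable
  have h2 : IntervalIntegrable (fun x ↦ φ x • g x) volume 0 R :=
    hg.continuousOn_smul hφ.continuous.continuousOn
  refine ⟨h1, h2, ?_⟩
  have hprod : AbsolutelyContinuousOnInterval
      (fun x ↦ φ x • (c + ∫ t in (0 : ℝ)..x, g t)) 0 R :=
    (hφ.contDiffOn.absolutelyContinuousOnInterval).fun_smul hG2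
  have hJ := absolutelyContinuousOnInterval_primitive (h1.add h2)
  have hzero : ∀ᵐ x, x ∈ uIcc 0 R → HasDerivAt (fun x ↦ φ x • (c + ∫ t in (0 : ℝ)..x, g t)
      - ∫ t in (0 : ℝ)..x, (deriv φ t • (c + ∫ s in (0 : ℝ)..t, g s) + φ t • g t)) 0 x := by
    filter_upwards [hg.ae_hasDerivAt_integral, (h1.add h2).ae_hasDerivAt_integral] with x hx1 hx2 hx
    have e1 := ((hφ.differentiable one_ne_zero x).hasDerivAt).smul
      ((hx1 hx 0 left_mem_uIcc).const_add c)
    have e2 := e1.sub (hx2 hx 0 left_mem_uIcc)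
    refine e2.congr_deriv ?_
    abel
  obtain ⟨C, hC⟩ := (hprod.fun_sub hJ).const_of_ae_hasDerivAt_zero hzero
  have e0 := hC 0 left_mem_uIcc
  have eR := hC R right_mem_uIcc
  simp only [intervalIntegral.integral_same, add_zero, sub_zero] at e0
  rw [intervalIntegral.integral_add h1 h2, ← e0] at eR
  rw [← eR]; abel

theorem intervalIntegrable_of_memLp_Ioi {E : Type*} [NormedAddCommGroup E] {g : ℝ → E}
    (hg : MemLp g 2 (volume.restrict (Ioi 0)))
    {x y : ℝ} (hx : 0 ≤ x) (hy : 0 ≤ y) : IntervalIntegrable g volume x y := by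
  rw [intervalIntegrable_iff]
  have hL : MemLp g 2 (volume.restrict (uIoc x y)) :=
    hg.mono_measure (Measure.restrict_mono (fun t ht ↦ lt_of_le_of_lt (le_min hx hy) ht.1) le_rfl)
  have : IsFiniteMeasure (volume.restrict (uIoc x y)) := ⟨by simp [uIoc]⟩
  exact hL.integrable (by norm_num)

theorem continuousOn_primitive_Ici {g : ℝ → ℂ} (hg : MemLp g 2 (volume.restrict (Ioi 0))) (c : ℂ) :
    ContinuousOn (fun x ↦ c + ∫ t in (0 : ℝ)..x, g t) (Ici 0) := by
  intro x hx
  have h := (absolutelyContinuousOnInterval_primitive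
    (intervalIntegrable_of_memLp_Ioi hg le_rfl
      (by linarith [mem_Ici.1 hx] : 0 ≤ x + 1))).continuousOn
  rw [uIcc_of_le (by linarith [mem_Ici.1 hx])] at h
  have hx2 := h x ⟨hx, by linarith⟩
  refine (continuousWithinAt_const.add hx2).mono_of_mem_nhdsWithin ?_
  have : Iic (x + 1) ∈ 𝓝 x := Iic_mem_nhds (by linarith)
  filter_upwards [self_mem_nhdsWithin, mem_nhdsWithin_of_mem_nhds this] with y h1 h2
  exact ⟨h1, h2⟩

theorem exists_Icc_of_isCompact_subset_Ioi {K : Set ℝ} (hK : IsCompact K) (h : K ⊆ Ioi 0) :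
    ∃ a b, 0 < a ∧ a < b ∧ K ⊆ Icc a b := by
  rcases K.eq_empty_or_nonempty with rfl | hne
  · exact ⟨1, 2, by norm_num, by norm_num, empty_subset _⟩
  obtain ⟨a, ha, ha'⟩ := hK.exists_isLeast hne
  obtain ⟨b, hb, hb'⟩ := hK.exists_isGreatest hne
  exact ⟨a, b + 1, h ha, by linarith [ha' hb], fun x hx ↦ ⟨ha' hx, by linarith [hb' hx]⟩⟩

theorem setIntegral_Ioi_eq_intervalIntegral {E : Type*} [NormedAddCommGroup E] [NormedSpace ℝ E]
    {F : ℝ → E} {R : ℝ} (hR : 0 ≤ R) (h : ∀ x, R < x → F x = 0) :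
    ∫ x in Ioi 0, F x = ∫ x in (0 : ℝ)..R, F x := by
  rw [intervalIntegral.integral_of_le hR]
  refine setIntegral_eq_of_subset_of_forall_sdiff_eq_zero measurableSet_Ioi
    (fun x hx ↦ hx.1) fun x hx ↦ h x ?_
  by_contra hxR
  exact hx.2 ⟨hx.1, not_lt.1 hxR⟩

theorem deriv_eq_zero_of_notMem_tsupport {φ : ℝ → ℝ} {x : ℝ} (hx : x ∉ tsupport φ) :
    deriv φ x = 0 := by
  by_contra h
  exact hx (support_deriv_subset h)

theorem hasWeakDerivOn_primitive {g : ℝ → ℂ} (hg : MemLp g 2 (volume.restrict (Ioi 0))) (c : ℂ) :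
    HasWeakDerivOn (Ioi 0) (fun x ↦ c + ∫ t in (0 : ℝ)..x, g t) g := by
  refine ⟨((continuousOn_primitive_Ici hg c).mono Ioi_subset_Ici_self).locallyIntegrableOn
    measurableSet_Ioi, locallyIntegrableOn_of_locallyIntegrable_restrict
      (hg.locallyIntegrable (by norm_num)), fun φ hφ ↦ ?_⟩
  obtain ⟨hφ1, hφ2, hφ3⟩ := hφ
  obtain ⟨a, b, ha, hab, hK⟩ := exists_Icc_of_isCompact_subset_Ioi hφ2 hφ3
  have hb : 0 ≤ b := by linarith
  have hR : ∀ x, b < x → x ∉ tsupport φ := fun x hx h ↦ not_lt.2 (hK h).2 hx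
  have h0 : φ 0 = 0 := image_eq_zero_of_notMem_tsupport fun h ↦ not_lt.2 (hK h).1 ha
  -- The support lies in `[a, b]` with `0 < a`, so both boundary terms on `[0, b + 1]` vanish.
  have h1 : φ (b + 1) = 0 := image_eq_zero_of_notMem_tsupport (hR _ (by linarith))
  have key := (integral_deriv_smul_primitive_add (hφ1.of_le (by exact_mod_cast le_top))
    (intervalIntegrable_of_memLp_Ioi hg le_rfl (by linarith : 0 ≤ b + 1)) c).2.2
  rw [setIntegral_Ioi_eq_intervalIntegral (by linarith : 0 ≤ b + 1) fun x hx ↦ by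
      rw [deriv_eq_zero_of_notMem_tsupport (hR x (by linarith)), zero_smul],
    setIntegral_Ioi_eq_intervalIntegral (by linarith : 0 ≤ b + 1) fun x hx ↦ by
      rw [image_eq_zero_of_notMem_tsupport (hR x (by linarith)), zero_smul]]
  rw [h0, h1, zero_smul, zero_smul, sub_zero] at key
  exact eq_neg_of_add_eq_zero_left key

/-! ### The du Bois-Reymond lemma on the half-line. -/

theorem exists_isTestFunction_integral_eq_one :
    ∃ η : ℝ → ℝ, IsTestFunction (Ioi 0) η ∧ ∫ x, η x = 1 := by
  let b : ContDiffBump (1 : ℝ) := ⟨1 / 4, 1 / 2, by norm_num, by norm_num⟩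
  refine ⟨b.normed volume, ⟨b.contDiff_normed, b.hasCompactSupport_normed, ?_⟩,
    b.integral_normed⟩
  rw [b.tsupport_normed_eq, Real.closedBall_eq_Icc]
  intro x hx
  have : (1 : ℝ) - 1 / 2 ≤ x := hx.1
  exact mem_Ioi.2 (by linarith)

theorem IsTestFunction.integrable {Ω : Set ℝ} {φ : ℝ → ℝ} (h : IsTestFunction Ω φ) :
    Integrable φ := h.1.continuous.integrable_of_hasCompactSupport h.2.1

/-- A test function of integral zero is the derivative of a test function. -/
theorem IsTestFunction.exists_primitive {ψ : ℝ → ℝ} (hψ : IsTestFunction (Ioi 0) ψ)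
    (h0 : ∫ x, ψ x = 0) : ∃ φ, IsTestFunction (Ioi 0) φ ∧ deriv φ = ψ := by
  obtain ⟨a, b, ha, hab, hK⟩ := exists_Icc_of_isCompact_subset_Ioi hψ.2.1 hψ.2.2
  have hcont : Continuous ψ := hψ.1.continuous
  have hderiv : ∀ x, HasDerivAt (fun x ↦ ∫ t in (0 : ℝ)..x, ψ t) (ψ x) x := fun x ↦
    intervalIntegral.integral_hasDerivAt_right (hcont.intervalIntegrable _ _)
      hcont.stronglyMeasurable.stronglyMeasurableAtFilter hcont.continuousAt
  have hd : deriv (fun x ↦ ∫ t in (0 : ℝ)..x, ψ t) = ψ := funext fun x ↦ (hderiv x).deriv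
  have hz : ∀ x, x ∉ Icc a b → ψ x = 0 := fun x hx ↦
    image_eq_zero_of_notMem_tsupport fun h ↦ hx (hK h)
  have hs : Function.support (fun x ↦ ∫ t in (0 : ℝ)..x, ψ t) ⊆ Icc a b := by
    intro x hx
    by_contra hxab
    apply hx
    rcases lt_or_ge x a with hxa | hxa
    · refine intervalIntegral.integral_zero_ae (Eventually.of_forall fun t ht ↦ hz t fun h ↦ ?_)
      rcases ht with ⟨_, ht2⟩
      have h1 := h.1
      have : t < a := lt_of_le_of_lt ht2 (max_lt ha hxa)
      linarith
    -- Beyond the support the primitive equals the full integral; this is where the zero mean is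
    -- used.
    · have hxb : b < x := not_le.1 fun h ↦ hxab ⟨hxa, h⟩
      have hx0 : 0 ≤ x := by linarith
      change ∫ t in (0 : ℝ)..x, ψ t = 0
      rw [intervalIntegral.integral_of_le hx0]
      refine Eq.trans ?_ h0
      refine setIntegral_eq_integral_of_forall_compl_eq_zero fun t ht ↦ hz t fun h ↦ ht ?_
      exact ⟨by linarith [h.1], by linarith [h.2]⟩
  refine ⟨_, ⟨?_, HasCompactSupport.of_support_subset_isCompact isCompact_Icc hs, ?_⟩, hd⟩
  · rw [contDiff_infty_iff_deriv]
    exact ⟨fun x ↦ (hderiv x).differentiableAt, by rw [hd]; exact hψ.1⟩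
  · exact (closure_minimal hs isClosed_Icc).trans fun x hx ↦ lt_of_lt_of_le ha hx.1

theorem IsTestFunction.integrableOn_smul {Ω : Set ℝ} {φ : ℝ → ℝ}
    (hφ : IsTestFunction Ω φ) {h : ℝ → ℂ} (hh : LocallyIntegrableOn h Ω) :
    IntegrableOn (fun x ↦ φ x • h x) Ω := by
  have h1 : IntegrableOn (fun x ↦ φ x • h x) (tsupport φ) :=
    ((hh.integrableOn_compact_subset hφ.2.2 hφ.2.1)).continuousOn_smul
      hφ.1.continuous.continuousOn hφ.2.1
  refine (h1.integrable_of_forall_notMem_eq_zero fun x hx ↦ ?_).integrableOn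
  rw [image_eq_zero_of_notMem_tsupport hx, zero_smul]

theorem IsTestFunction.smul_setIntegral_eq {Ω : Set ℝ} {φ : ℝ → ℝ}
    (hφ : IsTestFunction Ω φ) (h : ℝ → ℂ) :
    ∫ x in Ω, φ x • h x = ∫ x, φ x • h x :=
  setIntegral_eq_integral_of_forall_compl_eq_zero fun x hx ↦ by
    rw [image_eq_zero_of_notMem_tsupport fun h ↦ hx (hφ.2.2 h), zero_smul]

theorem IsTestFunction.deriv {Ω : Set ℝ} {φ : ℝ → ℝ} (hφ : IsTestFunction Ω φ) :
    IsTestFunction Ω (deriv φ) :=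
  ⟨(contDiff_infty_iff_deriv.1 hφ.1).2, hφ.2.1.deriv,
    (closure_minimal support_deriv_subset (isClosed_tsupport φ)).trans hφ.2.2⟩

theorem ae_eq_zero_of_forall_isTestFunction {Ω : Set ℝ} (hΩ : IsOpen Ω) {h : ℝ → ℂ}
    (hh : LocallyIntegrableOn h Ω)
    (H : ∀ φ, IsTestFunction Ω φ → ∫ x in Ω, φ x • h x = 0) : ∀ᵐ x ∂volume.restrict Ω, h x = 0 := by
  rw [ae_restrict_iff' hΩ.measurableSet]
  refine hΩ.ae_eq_zero_of_integral_contDiff_smul_eq_zero hh fun φ h1 h2 h3 ↦ ?_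
  have hφ : IsTestFunction Ω φ := ⟨h1, h2, h3⟩
  rw [← hφ.smul_setIntegral_eq, H φ hφ]

/-- A locally integrable function on the half-line with vanishing weak derivative is constant. -/
theorem exists_ae_eq_const_of_integral_deriv_eq_zero {h : ℝ → ℂ}
    (hh : LocallyIntegrableOn h (Ioi 0))
    (H : ∀ φ, IsTestFunction (Ioi 0) φ → ∫ x in Ioi 0, deriv φ x • h x = 0) :
    ∃ c : ℂ, ∀ᵐ x ∂volume.restrict (Ioi 0), h x = c := by
  obtain ⟨η, hη, hη1⟩ := exists_isTestFunction_integral_eq_one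
  refine ⟨∫ x in Ioi 0, η x • h x, ?_⟩
  have hcl : LocallyIntegrableOn (fun _ : ℝ ↦ ∫ x in Ioi 0, η x • h x) (Ioi 0) :=
    (locallyIntegrable_const _).locallyIntegrableOn _
  have := ae_eq_zero_of_forall_isTestFunction isOpen_Ioi (hh.sub hcl) fun ψ hψ ↦ ?_
  · filter_upwards [this] with x hx using sub_eq_zero.1 hx
  set I := ∫ x, ψ x
  -- Subtracting the multiple of `η` with the same integral leaves zero mean, hence a derivative,
  -- against which `h` integrates to zero. This says that `h - ∫ η h` is orthogonal to `ψ`.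
  have hζ : IsTestFunction (Ioi 0) (fun x ↦ ψ x - I * η x) := by
    refine ⟨hψ.1.sub (contDiff_const.mul hη.1), hψ.2.1.sub hη.2.1.mul_left, ?_⟩
    exact (tsupport_sub _ _).trans
      (union_subset hψ.2.2 ((tsupport_mul_subset_right).trans hη.2.2))
  have hζ0 : ∫ x, (ψ x - I * η x) = 0 := by
    rw [integral_sub hψ.integrable (hη.integrable.const_mul _), integral_const_mul, hη1]
    simp [I]
  obtain ⟨φ, hφ, hφ'⟩ := hζ.exists_primitive hζ0
  have e := H φ hφ
  rw [hφ'] at e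
  have i1 := hψ.integrableOn_smul hh
  have i2 := hη.integrableOn_smul hh
  have i3 := hψ.integrableOn_smul hcl
  simp only [sub_smul, mul_smul] at e
  rw [integral_sub i1 (i2.integrable.fun_smul I), integral_smul] at e
  simp only [Pi.sub_apply, smul_sub]
  rw [integral_sub i1 i3, hψ.smul_setIntegral_eq (fun _ ↦ ∫ x in Ioi 0, η x • h x),
    integral_smul_const]
  exact e

/-- The difference of `f` and the primitive of `g` has zero weak derivative. -/
theorem HasWeakDerivOn.exists_ae_eq_primitive {f g : ℝ → ℂ} (h : HasWeakDerivOn (Ioi 0) f g)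
    (hg : MemLp g 2 (volume.restrict (Ioi 0))) :
    ∃ c : ℂ, ∀ᵐ x ∂volume.restrict (Ioi 0), f x = c + ∫ t in (0 : ℝ)..x, g t := by
  have hG := hasWeakDerivOn_primitive hg 0
  obtain ⟨c, hc⟩ := exists_ae_eq_const_of_integral_deriv_eq_zero (h.1.sub hG.1) fun φ hφ ↦ by
    simp only [Pi.sub_apply, smul_sub]
    rw [integral_sub (hφ.deriv.integrableOn_smul h.1)
      (hφ.deriv.integrableOn_smul hG.1), h.2.2 φ hφ, hG.2.2 φ hφ, sub_self]
  refine ⟨c, ?_⟩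
  filter_upwards [hc] with x hx
  rw [← hx]
  simp

/-! ### Uniqueness of weak derivatives and traces; reflection. -/

theorem HasWeakDerivOn.congr {Ω : Set ℝ} (hΩ : IsOpen Ω) {f f' g : ℝ → ℂ}
    (h : HasWeakDerivOn Ω f g) (hf : f =ᵐ[volume.restrict Ω] f') : HasWeakDerivOn Ω f' g := by
  refine ⟨?_, h.2.1, fun φ hφ ↦ ?_⟩
  · have := h.1
    rw [locallyIntegrableOn_iff hΩ.isLocallyClosed] at this ⊢
    exact fun k hk hkc ↦ (this k hk hkc).congr_fun_ae
      (hf.filter_mono (ae_mono (Measure.restrict_mono hk le_rfl)))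
  · rw [← h.2.2 φ hφ]
    refine integral_congr_ae ?_
    filter_upwards [hf] with x hx
    rw [hx]

theorem weakDeriv_ae_eq {Ω : Set ℝ} (hΩ : IsOpen Ω) {f g : ℝ → ℂ} (h : HasWeakDerivOn Ω f g) :
    weakDeriv Ω f =ᵐ[volume.restrict Ω] g := by
  have hex : ∃ g, HasWeakDerivOn Ω f g := ⟨g, h⟩
  have hw : HasWeakDerivOn Ω f (weakDeriv Ω f) := by
    rw [weakDeriv, dif_pos hex]; exact hex.choose_spec
  have := ae_eq_zero_of_forall_isTestFunction hΩ (hw.2.1.sub h.2.1) fun φ hφ ↦ by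
    simp only [Pi.sub_apply, smul_sub]
    rw [integral_sub (hφ.integrableOn_smul hw.2.1) (hφ.integrableOn_smul h.2.1),
      sub_eq_zero, ← neg_inj, ← hw.2.2 φ hφ, ← h.2.2 φ hφ]
  filter_upwards [this] with x hx using sub_eq_zero.1 hx

/-- Makes the choice in the definition harmless: two continuous representatives agree on the open
set and, by continuity, on its closure. -/
theorem boundaryValue_eq {Ω : Set ℝ} (hΩ : IsOpen Ω) {f : ℝ → ℂ} {p : ℝ} (hp : p ∈ closure Ω)
    {c : ℂ} (h : HasBoundaryValue Ω f p c) : boundaryValue Ω f p = c := by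
  have hex : ∃ c, HasBoundaryValue Ω f p c := ⟨c, h⟩
  rw [boundaryValue, dif_pos hex]
  obtain ⟨w, hw1, hw2, hw3⟩ := hex.choose_spec
  obtain ⟨w', hw1', hw2', rfl⟩ := h
  rw [← hw3]
  have hE : EqOn w w' Ω := Measure.eqOn_open_of_ae_eq (hw2.trans hw2'.symm) hΩ
    (hw1.mono subset_closure) (hw1'.mono subset_closure)
  exact hE.of_subset_closure hw1 hw1' subset_closure subset_rfl hp

theorem IsTestFunction.comp_neg {Ω : Set ℝ} {φ : ℝ → ℝ} (hφ : IsTestFunction Ω φ) :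
    IsTestFunction (Neg.neg ⁻¹' Ω) (fun x ↦ φ (-x)) := by
  refine ⟨hφ.1.comp contDiff_neg, hφ.2.1.comp_homeomorph (Homeomorph.neg ℝ), ?_⟩
  have := tsupport_comp_subset_preimage φ (f := fun x : ℝ ↦ -x) continuous_neg
  exact this.trans (preimage_mono hφ.2.2)

theorem HasWeakDerivOn.comp_neg {Ω : Set ℝ} (hΩ : IsOpen Ω) {f g : ℝ → ℂ}
    (h : HasWeakDerivOn Ω f g) :
    HasWeakDerivOn (Neg.neg ⁻¹' Ω) (fun x ↦ f (-x)) (fun x ↦ -g (-x)) := by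
  have hloc : ∀ k : ℝ → ℂ, LocallyIntegrableOn k Ω →
      LocallyIntegrableOn (fun x ↦ k (-x)) (Neg.neg ⁻¹' Ω) := by
    intro k hk
    have hΩ' : IsOpen (Neg.neg ⁻¹' Ω) := hΩ.preimage continuous_neg
    rw [locallyIntegrableOn_iff hΩ.isLocallyClosed] at hk
    rw [locallyIntegrableOn_iff hΩ'.isLocallyClosed]
    intro K hK hKc
    have hK' := hk (Neg.neg '' K) (by rintro _ ⟨x, hx, rfl⟩; exact hK hx)
      (hKc.image continuous_neg)
    have := ((Measure.measurePreserving_neg (volume : Measure ℝ)).integrableOn_comp_preimage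
      (Homeomorph.neg ℝ).measurableEmbedding (f := k) (s := Neg.neg '' K)).2 hK'
    simpa [Function.comp_def] using this
  have hint : ∀ k : ℝ → ℂ, ∫ x in Neg.neg ⁻¹' Ω, k (-x) = ∫ x in Ω, k x := fun k ↦
    (Measure.measurePreserving_neg (volume : Measure ℝ)).setIntegral_preimage_emb
      (Homeomorph.neg ℝ).measurableEmbedding k Ω
  refine ⟨hloc f h.1, (hloc g h.2.1).neg, fun φ hφ ↦ ?_⟩
  have hφ' : IsTestFunction Ω (fun x ↦ φ (-x)) := by simpa [← preimage_comp] using hφ.comp_neg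
  have e := h.2.2 _ hφ'
  rw [← hint, ← hint] at e
  simp only [deriv_comp_neg, neg_neg, neg_smul, integral_neg, smul_neg] at e ⊢
  exact neg_inj.1 (by rw [e])

/-! ### Half-line profiles. -/

/-- `ρ` and `γ` play the roles of the moduli of an `H¹` function on `(0, ∞)`, continuous up to the
boundary, and of its derivative. -/
structure IsProfile (ρ γ : ℝ → ℝ) : Prop where
  nonneg : ∀ x, 0 ≤ ρ x
  slope_nonneg : ∀ x, 0 ≤ γ x
  memLp : MemLp ρ 2 (volume.restrict (Ioi 0))
  memLp_slope : MemLp γ 2 (volume.restrict (Ioi 0))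
  abs_sub_le : ∀ x y, 0 ≤ x → x ≤ y → |ρ y - ρ x| ≤ ∫ t in x..y, γ t

namespace IsProfile

variable {ρ γ : ℝ → ℝ}

theorem const_mul (h : IsProfile ρ γ) {t : ℝ} (ht : 0 ≤ t) :
    IsProfile (fun x ↦ t * ρ x) (fun x ↦ t * γ x) where
  nonneg x := mul_nonneg ht (h.nonneg x)
  slope_nonneg x := mul_nonneg ht (h.slope_nonneg x)
  memLp := h.memLp.const_mul t
  memLp_slope := h.memLp_slope.const_mul t
  abs_sub_le x y hx hxy := by
    rw [← mul_sub, abs_mul, abs_of_nonneg ht, intervalIntegral.integral_const_mul]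
    exact mul_le_mul_of_nonneg_left (h.abs_sub_le x y hx hxy) ht

theorem intervalIntegrable_slope (h : IsProfile ρ γ) {x y : ℝ} (hx : 0 ≤ x) (hy : 0 ≤ y) :
    IntervalIntegrable γ volume x y := intervalIntegrable_of_memLp_Ioi h.memLp_slope hx hy

theorem dist_le (h : IsProfile ρ γ) {a x y : ℝ} (ha : 0 ≤ a) (hx : 0 ≤ x) (hy : 0 ≤ y) :
    dist (ρ x) (ρ y) ≤ dist (∫ t in a..x, γ t) (∫ t in a..y, γ t) := by
  wlog hxy : x ≤ y generalizing x y
  · rw [dist_comm, dist_comm (∫ t in a..x, γ t)]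
    exact this hy hx (le_of_not_ge hxy)
  rw [dist_comm, Real.dist_eq, dist_comm, Real.dist_eq,
    intervalIntegral.integral_interval_sub_left (h.intervalIntegrable_slope ha hy)
      (h.intervalIntegrable_slope ha hx)]
  exact (h.abs_sub_le x y hx hxy).trans (le_abs_self _)

theorem absolutelyContinuousOnInterval (h : IsProfile ρ γ) {a b : ℝ} (ha : 0 ≤ a) (hab : a ≤ b) :
    AbsolutelyContinuousOnInterval ρ a b := by
  refine absolutelyContinuousOnInterval_of_dist_le (K := 1)
    ((h.intervalIntegrable_slope ha
      (ha.trans hab)).absolutelyContinuousOnInterval_intervalIntegral left_mem_uIcc)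
    fun x hx y hy ↦ ?_
  rw [uIcc_of_le hab] at hx hy
  rw [one_mul]
  exact h.dist_le ha (ha.trans hx.1) (ha.trans hy.1)

theorem continuousOn (h : IsProfile ρ γ) : ContinuousOn ρ (Ici 0) := by
  intro x hx
  have hc := (h.absolutelyContinuousOnInterval le_rfl
    (by linarith [mem_Ici.1 hx] : 0 ≤ x + 1)).continuousOn
  rw [uIcc_of_le (by linarith [mem_Ici.1 hx])] at hc
  refine (hc x ⟨hx, by linarith⟩).mono_of_mem_nhdsWithin ?_
  have : Iic (x + 1) ∈ 𝓝 x := Iic_mem_nhds (by linarith)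
  filter_upwards [self_mem_nhdsWithin, mem_nhdsWithin_of_mem_nhds this] with y h1 h2
  exact ⟨h1, h2⟩

/-- Difference quotients of `ρ` are dominated by those of the primitive of `γ`; pass to the limit
where both functions are differentiable. -/
theorem ae_abs_deriv_le (h : IsProfile ρ γ) {a b : ℝ} (ha : 0 ≤ a) (hab : a ≤ b) :
    ∀ᵐ x, x ∈ Ioo a b → DifferentiableAt ℝ ρ x ∧ |deriv ρ x| ≤ γ x := by
  filter_upwards [(h.absolutelyContinuousOnInterval ha hab).ae_differentiableAt,
    (h.intervalIntegrable_slope ha (ha.trans hab)).ae_hasDerivAt_integral] with x h1 h2 hx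
  have hx' : x ∈ uIcc a b := by rw [uIcc_of_le hab]; exact Ioo_subset_Icc_self hx
  have d1 := (h1 hx').hasDerivAt
  have d2 := h2 hx' a left_mem_uIcc
  refine ⟨h1 hx', ?_⟩
  have t1 := (hasDerivAt_iff_tendsto_slope.1 d1).abs
  have t2 := (hasDerivAt_iff_tendsto_slope.1 d2).abs
  rw [abs_of_nonneg (h.slope_nonneg x)] at t2
  refine le_of_tendsto_of_tendsto t1 t2 ?_
  filter_upwards [mem_nhdsWithin_of_mem_nhds (Ioo_mem_nhds hx.1 hx.2)] with y hy
  rw [slope_def_field, slope_def_field, abs_div, abs_div]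
  exact div_le_div_of_nonneg_right (h.dist_le ha (ha.trans hy.1.le) (ha.trans hx.1.le))
    (abs_nonneg _)

/-- The chain rule inequality for a `C¹` function of the modulus. -/
theorem abs_comp_sub_le (h : IsProfile ρ γ) {A W : ℝ → ℝ} (hA : ∀ x, HasDerivAt A (W x) x)
    (hW : Continuous W) (hW0 : ∀ x, 0 ≤ x → 0 ≤ W x) {a b : ℝ} (ha : 0 ≤ a) (hab : a ≤ b) :
    |A (ρ b) - A (ρ a)| ≤ ∫ x in a..b, W (ρ x) * γ x := by
  have hac := h.absolutelyContinuousOnInterval ha hab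
  have hAc : ContDiff ℝ 1 A := contDiff_one_iff_deriv.2
    ⟨fun x ↦ (hA x).differentiableAt, by rwa [funext fun x ↦ (hA x).deriv]⟩
  -- `A` is Lipschitz on the bounded range of `ρ`, so `A ∘ ρ` is absolutely continuous and is
  -- recovered by integrating its derivative.
  obtain ⟨M, hM⟩ := hac.exists_bound
  have hM' : ∀ x ∈ uIcc a b, ρ x ∈ Icc (-M) M := fun x hx ↦ abs_le.1 (hM x hx)
  obtain ⟨K, hK⟩ := hAc.contDiffOn.exists_lipschitzOnWith one_ne_zero (convex_Icc (-M) M)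
    isCompact_Icc
  have hcomp : AbsolutelyContinuousOnInterval (fun x ↦ A (ρ x)) a b :=
    absolutelyContinuousOnInterval_of_dist_le hac fun x hx y hy ↦
      hK.dist_le_mul _ (hM' x hx) _ (hM' y hy)
  have hint : IntervalIntegrable (fun x ↦ W (ρ x) * γ x) volume a b :=
    (h.intervalIntegrable_slope ha (ha.trans hab)).continuousOn_mul
      (hW.comp_continuousOn hac.continuousOn)
  rw [← hcomp.integral_deriv_eq_sub]
  refine (intervalIntegral.abs_integral_le_integral_abs hab).trans ?_
  refine intervalIntegral.integral_mono_ae_restrict hab hcomp.intervalIntegrable_deriv.abs hint ?_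
  rw [← restrict_Ioo_eq_restrict_Icc]
  refine (ae_restrict_iff' measurableSet_Ioo).2 ?_
  filter_upwards [h.ae_abs_deriv_le ha hab] with x hx hxab
  obtain ⟨h1, h2⟩ := hx hxab
  have := ((hA (ρ x)).comp x h1.hasDerivAt).deriv
  simp only [Function.comp_def] at this
  rw [this, abs_mul, abs_of_nonneg (hW0 _ (h.nonneg x))]
  exact mul_le_mul_of_nonneg_left h2 (hW0 _ (h.nonneg x))

theorem integrableOn_sq (h : IsProfile ρ γ) : IntegrableOn (fun x ↦ ρ x ^ 2) (Ioi 0) :=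
  h.memLp.integrable_sq

theorem integrableOn_slope_sq (h : IsProfile ρ γ) : IntegrableOn (fun x ↦ γ x ^ 2) (Ioi 0) :=
  h.memLp_slope.integrable_sq

/-- For `x ≤ y`, `ρ(x)² - ρ(y)² ≤ ∫ 2ργ ≤ ∫ (ρ² + γ²)`, and square integrability prevents `ρ(y)`
from staying away from zero. The tail integral on the right then forces decay of `ρ`. -/
theorem sq_le_setIntegral_Ioi (h : IsProfile ρ γ) {x : ℝ} (hx : 0 ≤ x) :
    ρ x ^ 2 ≤ ∫ t in Ioi x, (ρ t ^ 2 + γ t ^ 2) := by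
  have hF : IntegrableOn (fun t ↦ ρ t ^ 2 + γ t ^ 2) (Ioi 0) :=
    h.integrableOn_sq.add h.integrableOn_slope_sq
  have hFx : IntegrableOn (fun t ↦ ρ t ^ 2 + γ t ^ 2) (Ioi x) := hF.mono_set (Ioi_subset_Ioi hx)
  have hstep : ∀ y, x ≤ y → ρ x ^ 2 - ρ y ^ 2 ≤ ∫ t in Ioi x, (ρ t ^ 2 + γ t ^ 2) := by
    intro y hxy
    have h1 := h.abs_comp_sub_le (A := fun r ↦ r ^ 2) (W := fun r ↦ 2 * r)
      (fun r ↦ by simpa using hasDerivAt_pow 2 r) (by fun_prop) (fun r hr ↦ by linarith) hx hxy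
    have h2 : ∫ t in x..y, 2 * ρ t * γ t ≤ ∫ t in x..y, (ρ t ^ 2 + γ t ^ 2) := by
      refine intervalIntegral.integral_mono_on hxy ?_ ?_ fun t _ ↦ two_mul_le_add_sq _ _
      · refine (h.intervalIntegrable_slope hx (hx.trans hxy)).continuousOn_mul ?_
        rw [uIcc_of_le hxy]
        exact continuousOn_const.mul (h.continuousOn.mono fun t ht ↦ hx.trans ht.1)
      · rw [intervalIntegrable_iff_integrableOn_Ioc_of_le hxy]
        exact hFx.mono_set Ioc_subset_Ioi_self
    have h3 : ∫ t in x..y, (ρ t ^ 2 + γ t ^ 2) ≤ ∫ t in Ioi x, (ρ t ^ 2 + γ t ^ 2) := by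
      rw [intervalIntegral.integral_of_le hxy]
      exact setIntegral_mono_set hFx (Eventually.of_forall fun t ↦ by positivity)
        Ioc_subset_Ioi_self.eventuallyLE
    have h4 := neg_le_of_abs_le h1
    linarith
  by_contra! hlt
  set T := ∫ t in Ioi x, (ρ t ^ 2 + γ t ^ 2)
  -- If the bound failed, `ρ²` would dominate a positive constant on `(x, ∞)`, making that constant
  -- integrable.
  have hc : IntegrableOn (fun _ : ℝ ↦ ρ x ^ 2 - T) (Ioi x) := by
    refine Integrable.mono' (h.integrableOn_sq.mono_set (Ioi_subset_Ioi hx))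
      aestronglyMeasurable_const ?_
    refine (ae_restrict_iff' measurableSet_Ioi).2 (Eventually.of_forall fun y hy ↦ ?_)
    rw [Real.norm_of_nonneg (by linarith)]
    linarith [hstep y (le_of_lt hy)]
  rw [integrableOn_const_iff] at hc
  rcases hc with hc | hc
  · exact (sub_pos.2 hlt).ne' (enorm_eq_zero.1 hc)
  · simp at hc

theorem tendsto_zero (h : IsProfile ρ γ) : Tendsto ρ atTop (𝓝 0) := by
  have hF : IntegrableOn (fun t ↦ ρ t ^ 2 + γ t ^ 2) (Ioi 0) :=
    h.integrableOn_sq.add h.integrableOn_slope_sq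
  have h1 := (tendsto_const_nhds (x := ∫ t in Ioi 0, (ρ t ^ 2 + γ t ^ 2))).sub
    (intervalIntegral_tendsto_integral_Ioi 0 hF tendsto_id)
  rw [sub_self] at h1
  have h2 : Tendsto (fun x ↦ ρ x ^ 2) atTop (𝓝 0) := by
    refine squeeze_zero' (Eventually.of_forall fun x ↦ sq_nonneg _) ?_ h1
    filter_upwards [eventually_ge_atTop 0] with x hx
    have h3 := intervalIntegral.integral_interval_add_Ioi (hF.mono_set (Ioi_subset_Ioi le_rfl))
      (hF.mono_set (Ioi_subset_Ioi hx))
    have := h.sq_le_setIntegral_Ioi hx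
    simp only [id]
    linarith
  have h3 := h2.sqrt
  simpa [Real.sqrt_sq (h.nonneg _)] using h3

theorem exists_isMax (h : IsProfile ρ γ) : ∃ x₀, 0 ≤ x₀ ∧ ∀ x, 0 ≤ x → ρ x ≤ ρ x₀ := by
  by_cases hz : ∀ x, 0 ≤ x → ρ x ≤ 0
  · exact ⟨0, le_rfl, fun x hx ↦ (hz x hx).trans (h.nonneg _)⟩
  push Not at hz
  obtain ⟨x₁, hx₁, hpos⟩ := hz
  obtain ⟨R, hR⟩ := eventually_atTop.1 (h.tendsto_zero.eventually (gt_mem_nhds hpos))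
  obtain ⟨x₀, hx₀, hmax⟩ := (isCompact_Icc (a := (0 : ℝ)) (b := max x₁ R)).exists_isMaxOn
    ⟨x₁, hx₁, le_max_left _ _⟩ (h.continuousOn.mono fun t ht ↦ ht.1)
  refine ⟨x₀, hx₀.1, fun x hx ↦ ?_⟩
  rcases le_total x (max x₁ R) with hle | hle
  · exact hmax ⟨hx, hle⟩
  · exact (hR x ((le_max_right _ _).trans hle)).le.trans (hmax ⟨hx₁, le_max_left _ _⟩)

theorem integrableOn_rpow (h : IsProfile ρ γ) {μ : ℝ} (hμ : 0 < μ) :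
    IntegrableOn (fun x ↦ ρ x ^ (2 * μ + 2)) (Ioi 0) := by
  obtain ⟨x₀, -, hmax⟩ := h.exists_isMax
  refine Integrable.mono' (h.integrableOn_sq.const_mul (ρ x₀ ^ (2 * μ))) ?_ ?_
  · exact (h.memLp.1.aemeasurable.pow_const _).aestronglyMeasurable
  · refine (ae_restrict_iff' measurableSet_Ioi).2 (Eventually.of_forall fun x hx ↦ ?_)
    rw [Real.norm_of_nonneg (Real.rpow_nonneg (h.nonneg x) _),
      Real.rpow_add_of_nonneg (h.nonneg x) (by linarith) (by norm_num), Real.rpow_two]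
    gcongr
    · exact h.nonneg x
    · exact hmax x (le_of_lt hx)

end IsProfile

/-! ### The lower bound for the half-line action. -/

/-- The function `θ` such that decaying solutions `f > 0` of the stationary equation satisfy
`|df/dx| = f θ(f)`. -/
def theta (μ ω r : ℝ) : ℝ := √(ω - r ^ (2 * μ) / (μ + 1))

/-- The action of the monotone solution on a half-line as a function of its boundary value. -/
def monotoneAction (μ ω x : ℝ) : ℝ := ∫ r in (0 : ℝ)..x, r * theta μ ω r

/-- The action of a half-line profile, without the boundary term. -/
def profileAction (μ ω : ℝ) (ρ γ : ℝ → ℝ) : ℝ :=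
  1 / 2 * (∫ x in Ioi 0, γ x ^ 2) + ω / 2 * (∫ x in Ioi 0, ρ x ^ 2)
    - 1 / (2 * μ + 2) * ∫ x in Ioi 0, ρ x ^ (2 * μ + 2)

theorem continuous_theta {μ : ℝ} (hμ : 0 < μ) (ω : ℝ) : Continuous (theta μ ω) := by
  have := Real.continuous_rpow_const (q := 2 * μ) (by linarith)
  unfold theta
  fun_prop

theorem theta_nonneg (μ ω r : ℝ) : 0 ≤ theta μ ω r := Real.sqrt_nonneg _

theorem hasDerivAt_monotoneAction {μ : ℝ} (hμ : 0 < μ) (ω x : ℝ) :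
    HasDerivAt (monotoneAction μ ω) (x * theta μ ω x) x := by
  have hc : Continuous fun r ↦ r * theta μ ω r := continuous_id.mul (continuous_theta hμ ω)
  exact intervalIntegral.integral_hasDerivAt_right (hc.intervalIntegrable _ _)
    hc.stronglyMeasurable.stronglyMeasurableAtFilter hc.continuousAt

theorem monotoneAction_zero (μ ω : ℝ) : monotoneAction μ ω 0 = 0 := by simp [monotoneAction]

theorem continuous_monotoneAction {μ : ℝ} (hμ : 0 < μ) (ω : ℝ) :
    Continuous (monotoneAction μ ω) :=
  continuous_iff_continuousAt.2 fun x ↦ (hasDerivAt_monotoneAction hμ ω x).continuousAt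

/-- Below the peak the square root is not truncated to `0`, so twice the potential is a perfect
square. -/
theorem sq_mul_theta_sq {μ ω r : ℝ} (hμ : 0 < μ) (hr : 0 ≤ r)
    (h : r ^ (2 * μ) ≤ (μ + 1) * ω) :
    (r * theta μ ω r) ^ 2 = ω * r ^ 2 - r ^ (2 * μ + 2) / (μ + 1) := by
  have h1 : 0 ≤ ω - r ^ (2 * μ) / (μ + 1) := by
    rw [sub_nonneg, div_le_iff₀ (by linarith)]; linarith
  rw [mul_pow, theta, Real.sq_sqrt h1, Real.rpow_add_of_nonneg hr (by linarith) (by norm_num),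
    Real.rpow_two]
  ring

/-- The action density is `(γ² + W(ρ)²)/2 ≥ W(ρ) γ`, which dominates the variation of `A ∘ ρ`. Going
from `0` to `x₀` costs at least `A(ρ x₀) - A(ρ 0)`, and from `x₀` to infinity, where `ρ` vanishes,
at least `A(ρ x₀)`. The point `x₀` need not be a maximum; `x₀ = 0` gives the bound for monotone
tails. -/
theorem IsProfile.le_profileAction {ρ γ : ℝ → ℝ} (h : IsProfile ρ γ) {μ ω : ℝ} (hμ : 0 < μ)
    (hbound : ∀ x, 0 ≤ x → ρ x ^ (2 * μ) ≤ (μ + 1) * ω) {x₀ : ℝ} (hx₀ : 0 ≤ x₀) :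
    2 * monotoneAction μ ω (ρ x₀) - monotoneAction μ ω (ρ 0) ≤ profileAction μ ω ρ γ := by
  set A := monotoneAction μ ω
  set W : ℝ → ℝ := fun r ↦ r * theta μ ω r with hWdef
  set F : ℝ → ℝ := fun x ↦ 1 / 2 * γ x ^ 2 + ω / 2 * ρ x ^ 2
    - 1 / (2 * μ + 2) * ρ x ^ (2 * μ + 2) with hF
  have hW : Continuous W := continuous_id.mul (continuous_theta hμ ω)
  have i1 := h.integrableOn_slope_sq.const_mul (1 / 2)
  have i2 := h.integrableOn_sq.const_mul (ω / 2)
  have i3 := (h.integrableOn_rpow hμ).const_mul (1 / (2 * μ + 2))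
  have hFi : IntegrableOn F (Ioi 0) := (i1.add i2).sub i3
  have hFeq : ∫ x in Ioi 0, F x = profileAction μ ω ρ γ := by
    have i12 : IntegrableOn (fun x ↦ 1 / 2 * γ x ^ 2 + ω / 2 * ρ x ^ 2) (Ioi 0) := i1.add i2
    rw [hF, integral_sub i12 i3, integral_add i1 i2, integral_const_mul,
      integral_const_mul, integral_const_mul, profileAction]
  have hFsq : ∀ x, 0 ≤ x → F x = 1 / 2 * γ x ^ 2 + 1 / 2 * W (ρ x) ^ 2 := by
    intro x hx
    rw [hWdef]
    simp only []
    rw [sq_mul_theta_sq hμ (h.nonneg x) (hbound x hx), hF]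
    have : μ + 1 ≠ 0 := by linarith
    field_simp
    ring
  have hFii : ∀ a b, 0 ≤ a → a ≤ b → IntervalIntegrable F volume a b := fun a b ha hab ↦ by
    rw [intervalIntegrable_iff_integrableOn_Ioc_of_le hab]
    exact hFi.mono_set fun t ht ↦ lt_of_le_of_lt ha ht.1
  have hseg : ∀ a b, 0 ≤ a → a ≤ b → |A (ρ b) - A (ρ a)| ≤ ∫ x in a..b, F x := by
    intro a b ha hab
    refine (h.abs_comp_sub_le (hasDerivAt_monotoneAction hμ ω) hW
      (fun r hr ↦ mul_nonneg hr (theta_nonneg _ _ _)) ha hab).trans ?_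
    refine intervalIntegral.integral_mono_on hab ?_ (hFii a b ha hab) fun x hx ↦ ?_
    · refine (h.intervalIntegrable_slope ha (ha.trans hab)).continuousOn_mul ?_
      rw [uIcc_of_le hab]
      exact hW.comp_continuousOn (h.continuousOn.mono fun t ht ↦ ha.trans ht.1)
    · rw [hFsq x (ha.trans hx.1)]
      nlinarith [sq_nonneg (γ x - W (ρ x))]
  have hlim : Tendsto (fun R ↦ 2 * A (ρ x₀) - A (ρ 0) - A (ρ R)) atTop
      (𝓝 (2 * A (ρ x₀) - A (ρ 0) - 0)) := by
    refine tendsto_const_nhds.sub ?_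
    have := ((continuous_monotoneAction hμ ω).tendsto 0).comp h.tendsto_zero
    rwa [monotoneAction_zero] at this
  rw [sub_zero] at hlim
  refine le_of_tendsto hlim ?_
  filter_upwards [eventually_ge_atTop x₀] with R hR
  have s1 := (le_abs_self _).trans (hseg 0 x₀ le_rfl hx₀)
  have s2 := (neg_le_abs _).trans (hseg x₀ R hx₀ hR)
  have s3 : (∫ x in (0 : ℝ)..x₀, F x) + ∫ x in x₀..R, F x = ∫ x in (0 : ℝ)..R, F x :=
    intervalIntegral.integral_add_adjacent_intervals (hFii _ _ le_rfl hx₀) (hFii _ _ hx₀ hR)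
  have s4 : ∫ x in (0 : ℝ)..R, F x ≤ ∫ x in Ioi 0, F x := by
    rw [intervalIntegral.integral_of_le (hx₀.trans hR)]
    refine setIntegral_mono_set hFi ?_ Ioc_subset_Ioi_self.eventuallyLE
    refine (ae_restrict_iff' measurableSet_Ioi).2 (Eventually.of_forall fun x hx ↦ ?_)
    rw [hFsq x (le_of_lt hx)]
    exact add_nonneg (by positivity) (by positivity)
  linarith

/-! ### The action as a function of the boundary value. -/

/-- The maximum of the soliton. -/
def peak (μ ω : ℝ) : ℝ := ((μ + 1) * ω) ^ (2 * μ)⁻¹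

section Theta

variable {μ ω : ℝ}

theorem peak_pos (hμ : 0 < μ) (hω : 0 < ω) : 0 < peak μ ω :=
  Real.rpow_pos_of_pos (by positivity) _

theorem peak_rpow (hμ : 0 < μ) (hω : 0 < ω) : peak μ ω ^ (2 * μ) = (μ + 1) * ω :=
  Real.rpow_inv_rpow (by positivity) (by positivity)

theorem rpow_le_of_le_peak (hμ : 0 < μ) (hω : 0 < ω) {r : ℝ} (hr : 0 ≤ r) (hr' : r ≤ peak μ ω) :
    r ^ (2 * μ) ≤ (μ + 1) * ω := by
  rw [← peak_rpow hμ hω]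
  exact Real.rpow_le_rpow hr hr' (by positivity)

theorem theta_sq (hμ : 0 < μ) (hω : 0 < ω) {r : ℝ} (hr : 0 ≤ r) (hr' : r ≤ peak μ ω) :
    theta μ ω r ^ 2 = ω - r ^ (2 * μ) / (μ + 1) := by
  refine Real.sq_sqrt ?_
  rw [sub_nonneg, div_le_iff₀ (by linarith)]
  linarith [rpow_le_of_le_peak hμ hω hr hr']

theorem theta_zero (hμ : 0 < μ) : theta μ ω 0 = √ω := by
  rw [theta, Real.zero_rpow (by positivity)]; simp

theorem theta_peak (hμ : 0 < μ) (hω : 0 < ω) : theta μ ω (peak μ ω) = 0 := by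
  rw [theta, peak_rpow hμ hω, mul_div_cancel_left₀ _ (by positivity), sub_self, Real.sqrt_zero]

/-- No upper bound by the peak is required, since the real square root is `0` on negative numbers.
-/
theorem theta_le_theta (hμ : 0 < μ) {x y : ℝ} (hx : 0 ≤ x) (hxy : x ≤ y) :
    theta μ ω y ≤ theta μ ω x := by
  unfold theta
  gcongr

/-- The squares of `θ` satisfy `θ(κx)² - θ(κy)² = κ^(2μ) (θ(x)² - θ(y)²)`. Factoring both sides,
`κ^(2μ) ≤ 1` together with `θ(κx) + θ(κy) ≥ θ(x) + θ(y)` shows that `θ(κ ·)` drops no more than `θ`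
does. -/
theorem monotoneOn_sq_mul_theta_sub_theta (hμ : 0 < μ) (hω : 0 < ω) {κ : ℝ} (hκ : 0 < κ)
    (hκ1 : κ ≤ 1) :
    MonotoneOn (fun x ↦ κ ^ 2 * theta μ ω (κ * x) - theta μ ω x) (Icc 0 (peak μ ω)) := by
  intro x hx y hy hxy
  have hkx : κ * x ≤ x := mul_le_of_le_one_left hx.1 hκ1
  have hky : κ * y ≤ y := mul_le_of_le_one_left hy.1 hκ1
  have hkx0 : 0 ≤ κ * x := mul_nonneg hκ.le hx.1
  have hky0 : 0 ≤ κ * y := mul_nonneg hκ.le hy.1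
  have s1 := theta_sq hμ hω hx.1 hx.2
  have s2 := theta_sq hμ hω hy.1 hy.2
  have s3 := theta_sq hμ hω hkx0 (hkx.trans hx.2)
  have s4 := theta_sq hμ hω hky0 (hky.trans hy.2)
  rw [Real.mul_rpow hκ.le hx.1] at s3
  rw [Real.mul_rpow hκ.le hy.1] at s4
  have m1 : theta μ ω y ≤ theta μ ω x := theta_le_theta hμ hx.1 hxy
  have m2 : theta μ ω (κ * y) ≤ theta μ ω (κ * x) :=
    theta_le_theta hμ hkx0 (mul_le_mul_of_nonneg_left hxy hκ.le)
  have m3 : theta μ ω x ≤ theta μ ω (κ * x) := theta_le_theta hμ hkx0 hkx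
  have m4 : theta μ ω y ≤ theta μ ω (κ * y) := theta_le_theta hμ hky0 hky
  have n1 := theta_nonneg μ ω x
  have n2 := theta_nonneg μ ω y
  have hk : κ ^ (2 * μ) ≤ 1 := Real.rpow_le_one hκ.le hκ1 (by positivity)
  have hk0 : 0 ≤ κ ^ (2 * μ) := Real.rpow_nonneg hκ.le _
  set a := theta μ ω x
  set b := theta μ ω y
  set c := theta μ ω (κ * x)
  set d := theta μ ω (κ * y)
  have hcd : (c - d) * (c + d) = κ ^ (2 * μ) * ((a - b) * (a + b)) := by
    have e1 : (c - d) * (c + d) = c ^ 2 - d ^ 2 := by ring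
    have e2 : (a - b) * (a + b) = a ^ 2 - b ^ 2 := by ring
    rw [e1, e2, s1, s2, s3, s4]
    ring
  have hle : c - d ≤ a - b := by
    have h0 : 0 ≤ (a - b) * (a + b) := mul_nonneg (by linarith) (by linarith)
    have h1 : (c - d) * (c + d) ≤ (a - b) * (c + d) := by
      rw [hcd]
      calc κ ^ (2 * μ) * ((a - b) * (a + b)) ≤ 1 * ((a - b) * (a + b)) :=
            mul_le_mul_of_nonneg_right hk h0
        _ ≤ (a - b) * (c + d) := by
            rw [one_mul]; exact mul_le_mul_of_nonneg_left (by linarith) (by linarith)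
    rcases (show 0 ≤ c + d by linarith).eq_or_lt with h2 | h2
    · linarith
    · exact le_of_mul_le_mul_right h1 h2
  have hκ2 : κ ^ 2 ≤ 1 := pow_le_one₀ hκ.le hκ1
  have : κ ^ 2 * (c - d) ≤ c - d := mul_le_of_le_one_left (by linarith) hκ2
  simp only []
  nlinarith

theorem monotoneOn_monotoneAction (hμ : 0 < μ) : MonotoneOn (monotoneAction μ ω) (Ici 0) := by
  refine monotoneOn_of_deriv_nonneg (convex_Ici 0) (continuous_monotoneAction hμ ω).continuousOn
    (fun x _ ↦ (hasDerivAt_monotoneAction hμ ω x).differentiableAt.differentiableWithinAt)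
    fun x hx ↦ ?_
  rw [interior_Ici] at hx
  rw [(hasDerivAt_monotoneAction hμ ω x).deriv]
  exact mul_nonneg (le_of_lt hx) (theta_nonneg _ _ _)

/-- Total action of a state that is monotone on both half-lines, with boundary values `x`
and `κ x`. -/
def tailAction (μ ω κ q x : ℝ) : ℝ :=
  monotoneAction μ ω x + monotoneAction μ ω (κ * x) - q / 2 * x ^ 2

/-- Total action of a state that is monotone on the half-line with boundary value `κ x` and has
its peak inside the half-line with boundary value `x`. -/
def bumpAction (μ ω κ q x : ℝ) : ℝ :=
  2 * monotoneAction μ ω (peak μ ω) - monotoneAction μ ω x + monotoneAction μ ω (κ * x)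
    - q / 2 * x ^ 2

theorem hasDerivAt_bumpAction (hμ : 0 < μ) (ω κ q x : ℝ) :
    HasDerivAt (bumpAction μ ω κ q) (x * (κ ^ 2 * theta μ ω (κ * x) - theta μ ω x - q)) x := by
  have h1 := hasDerivAt_monotoneAction hμ ω x
  have h2 := (hasDerivAt_monotoneAction hμ ω (κ * x)).comp x ((hasDerivAt_id x).const_mul κ)
  have h3 := (hasDerivAt_pow 2 x).const_mul (q / 2)
  have := ((h1.const_sub (2 * monotoneAction μ ω (peak μ ω))).add h2).sub h3
  refine this.congr_deriv ?_
  simp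
  ring

theorem continuous_bumpAction (hμ : 0 < μ) (ω κ q : ℝ) : Continuous (bumpAction μ ω κ q) :=
  continuous_iff_continuousAt.2 fun x ↦ (hasDerivAt_bumpAction hμ ω κ q x).continuousAt

theorem bumpAction_antitoneOn (hμ : 0 < μ) (hω : 0 < ω) {κ q : ℝ} (hκ : 0 < κ) (hκ1 : κ ≤ 1)
    {y : ℝ} (hy : y ≤ peak μ ω) (hy0 : 0 ≤ y) (h : κ ^ 2 * theta μ ω (κ * y) - theta μ ω y ≤ q) :
    AntitoneOn (bumpAction μ ω κ q) (Icc 0 y) := by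
  refine antitoneOn_of_deriv_nonpos (convex_Icc 0 y) (continuous_bumpAction hμ ω κ q).continuousOn
    (fun x _ ↦ (hasDerivAt_bumpAction hμ ω κ q x).differentiableAt.differentiableWithinAt)
    fun x hx ↦ ?_
  rw [interior_Icc] at hx
  rw [(hasDerivAt_bumpAction hμ ω κ q x).deriv]
  have := monotoneOn_sq_mul_theta_sub_theta hμ hω hκ hκ1 ⟨hx.1.le, hx.2.le.trans hy⟩ ⟨hy0, hy⟩
    hx.2.le
  simp only [] at this
  exact mul_nonpos_of_nonneg_of_nonpos hx.1.le (by linarith)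

theorem bumpAction_monotoneOn (hμ : 0 < μ) (hω : 0 < ω) {κ q : ℝ} (hκ : 0 < κ) (hκ1 : κ ≤ 1)
    {y : ℝ} (hy : y ≤ peak μ ω) (hy0 : 0 ≤ y) (h : q ≤ κ ^ 2 * theta μ ω (κ * y) - theta μ ω y) :
    MonotoneOn (bumpAction μ ω κ q) (Icc y (peak μ ω)) := by
  refine monotoneOn_of_deriv_nonneg (convex_Icc _ _) (continuous_bumpAction hμ ω κ q).continuousOn
    (fun x _ ↦ (hasDerivAt_bumpAction hμ ω κ q x).differentiableAt.differentiableWithinAt)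
    fun x hx ↦ ?_
  rw [interior_Icc] at hx
  rw [(hasDerivAt_bumpAction hμ ω κ q x).deriv]
  have := monotoneOn_sq_mul_theta_sub_theta hμ hω hκ hκ1 ⟨hy0, hy⟩
    ⟨hy0.trans hx.1.le, hx.2.le⟩ hx.1.le
  simp only [] at this
  exact mul_nonneg (hy0.trans hx.1.le) (by linarith)

/-- The bracket in the derivative of `bumpAction` is largest at the peak, where it is `κ² θ(κ m) -
q`. Its sign there decides between the two alternatives. The intermediate value theorem solves the
corresponding equation; the bound on `q` controls the tail equation at `0`. -/
theorem exists_critical (hμ : 0 < μ) (hω : 0 < ω) {κ q : ℝ} (hκ : 0 < κ) (hκ1 : κ ≤ 1)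
    (hq : 0 < q) (hqω : q < (1 + κ ^ 2) * √ω) :
    ∃ x, 0 < x ∧ x ≤ peak μ ω ∧
      ((theta μ ω x + κ ^ 2 * theta μ ω (κ * x) = q ∧
          ∀ y, 0 ≤ y → y ≤ x → tailAction μ ω κ q x ≤ bumpAction μ ω κ q y) ∨
        (-theta μ ω x + κ ^ 2 * theta μ ω (κ * x) = q ∧
          ∀ y, 0 ≤ y → y ≤ peak μ ω → bumpAction μ ω κ q x ≤ bumpAction μ ω κ q y)) := by
  have hm := peak_pos hμ hω
  have hθ := continuous_theta hμ ω
  have hsω : 0 < √ω := Real.sqrt_pos.2 hω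
  have hκ2 : κ ^ 2 ≤ 1 := pow_le_one₀ hκ.le hκ1
  rcases lt_or_ge (κ ^ 2 * theta μ ω (κ * peak μ ω)) q with hc | hc
  · have hcont : ContinuousOn (fun x ↦ theta μ ω x + κ ^ 2 * theta μ ω (κ * x))
        (Icc 0 (peak μ ω)) := by fun_prop
    obtain ⟨x, hx, hxq⟩ := intermediate_value_Ioo' hm.le hcont (show q ∈ _ by
      simp only [mem_Ioo, mul_zero, theta_zero hμ, theta_peak hμ hω]
      constructor <;> linarith)
    refine ⟨x, hx.1, hx.2.le, Or.inl ⟨hxq, fun y hy hyx ↦ ?_⟩⟩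
    have h1 := bumpAction_antitoneOn hμ hω hκ hκ1 le_rfl hm.le
      (show _ ≤ q by rw [theta_peak hμ hω]; linarith)
      ⟨hy, hyx.trans hx.2.le⟩ ⟨hx.1.le, hx.2.le⟩ hyx
    -- `A(x) ≤ A(m)` is exactly `tailAction ≤ bumpAction` at `x`.
    have h2 := monotoneOn_monotoneAction (ω := ω) hμ (mem_Ici.2 hx.1.le) (mem_Ici.2 hm.le) hx.2.le
    refine le_trans ?_ h1
    unfold tailAction bumpAction
    linarith
  · have hcont : ContinuousOn (fun x ↦ -theta μ ω x + κ ^ 2 * theta μ ω (κ * x))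
        (Icc 0 (peak μ ω)) := by fun_prop
    obtain ⟨x, hx, hxq⟩ := intermediate_value_Ioc hm.le hcont (show q ∈ _ by
      simp only [mem_Ioc, mul_zero, theta_zero hμ, theta_peak hμ hω]
      constructor
      · nlinarith
      · linarith)
    simp only [] at hxq
    refine ⟨x, hx.1, hx.2, Or.inr ⟨hxq, fun y hy hym ↦ ?_⟩⟩
    rcases le_total y x with hyx | hyx
    · exact bumpAction_antitoneOn hμ hω hκ hκ1 hx.2 hx.1.le (by linarith)
        ⟨hy, hyx⟩ ⟨hx.1.le, le_rfl⟩ hyx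
    · exact bumpAction_monotoneOn hμ hω hκ hκ1 hx.2 hx.1.le (by linarith)
        ⟨le_rfl, hx.2⟩ ⟨hyx, hym⟩ hyx

end Theta

/-! ### Lower bounds after rescaling a competitor. -/

section Profiles

variable {μ ω κ q : ℝ} {ρ₁ γ₁ ρ₂ γ₂ : ℝ → ℝ}

theorem IsProfile.monotoneAction_le (hμ : 0 < μ) (hω : 0 < ω) {ρ γ : ℝ → ℝ} (h : IsProfile ρ γ)
    (hb : ∀ x, 0 ≤ x → ρ x ≤ peak μ ω) : monotoneAction μ ω (ρ 0) ≤ profileAction μ ω ρ γ := by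
  have := h.le_profileAction hμ
    (fun x hx ↦ rpow_le_of_le_peak hμ hω (h.nonneg x) (hb x hx)) le_rfl
  linarith

theorem tailAction_le (hμ : 0 < μ) (hω : 0 < ω) (h₁ : IsProfile ρ₁ γ₁) (h₂ : IsProfile ρ₂ γ₂)
    (h0 : ρ₂ 0 = κ * ρ₁ 0) (b₁ : ∀ x, 0 ≤ x → ρ₁ x ≤ peak μ ω)
    (b₂ : ∀ x, 0 ≤ x → ρ₂ x ≤ peak μ ω) :
    tailAction μ ω κ q (ρ₁ 0)
      ≤ profileAction μ ω ρ₁ γ₁ + profileAction μ ω ρ₂ γ₂ - q / 2 * ρ₁ 0 ^ 2 := by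
  have e1 := h₁.monotoneAction_le hμ hω b₁
  have e2 := h₂.monotoneAction_le hμ hω b₂
  rw [h0] at e2
  unfold tailAction
  linarith

/-- A peak on the side of the smaller boundary value costs more: it exchanges the roles of `A(x)`
and `A(κ x)`, and `A(κ x) ≤ A(x)`. -/
theorem bumpAction_le (hμ : 0 < μ) (hω : 0 < ω) (hκ : 0 < κ) (hκ1 : κ ≤ 1)
    (h₁ : IsProfile ρ₁ γ₁) (h₂ : IsProfile ρ₂ γ₂)
    (h0 : ρ₂ 0 = κ * ρ₁ 0) (b₁ : ∀ x, 0 ≤ x → ρ₁ x ≤ peak μ ω)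
    (b₂ : ∀ x, 0 ≤ x → ρ₂ x ≤ peak μ ω)
    (hp : (∃ x, 0 ≤ x ∧ ρ₁ x = peak μ ω) ∨ ∃ x, 0 ≤ x ∧ ρ₂ x = peak μ ω) :
    bumpAction μ ω κ q (ρ₁ 0)
      ≤ profileAction μ ω ρ₁ γ₁ + profileAction μ ω ρ₂ γ₂ - q / 2 * ρ₁ 0 ^ 2 := by
  unfold bumpAction
  rcases hp with ⟨x, hx, hxp⟩ | ⟨x, hx, hxp⟩
  · have e1 := h₁.le_profileAction hμ
      (fun x hx ↦ rpow_le_of_le_peak hμ hω (h₁.nonneg x) (b₁ x hx)) hx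
    have e2 := h₂.monotoneAction_le hμ hω b₂
    rw [hxp] at e1
    rw [h0] at e2
    linarith
  · have e1 := h₂.le_profileAction hμ
      (fun x hx ↦ rpow_le_of_le_peak hμ hω (h₂.nonneg x) (b₂ x hx)) hx
    have e2 := h₁.monotoneAction_le hμ hω b₁
    have e3 := monotoneOn_monotoneAction (ω := ω) hμ
      (mem_Ici.2 (mul_nonneg hκ.le (h₁.nonneg 0))) (mem_Ici.2 (h₁.nonneg 0))
      (mul_le_of_le_one_left (h₁.nonneg 0) hκ1)
    rw [hxp, h0] at e1
    linarith

/-- The factor is the peak divided by the larger of the two maxima: the potential is then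
nonnegative along both profiles, and one of them touches the peak. -/
theorem exists_scaling (hμ : 0 < μ) (hω : 0 < ω) (h₁ : IsProfile ρ₁ γ₁) (h₂ : IsProfile ρ₂ γ₂)
    (hne : ∃ x, 0 ≤ x ∧ (ρ₁ x ≠ 0 ∨ ρ₂ x ≠ 0)) :
    ∃ t, 0 < t ∧ (∀ x, 0 ≤ x → t * ρ₁ x ≤ peak μ ω) ∧ (∀ x, 0 ≤ x → t * ρ₂ x ≤ peak μ ω) ∧
      ((∃ x, 0 ≤ x ∧ t * ρ₁ x = peak μ ω) ∨ ∃ x, 0 ≤ x ∧ t * ρ₂ x = peak μ ω) := by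
  obtain ⟨x₁, hx₁, hmax₁⟩ := h₁.exists_isMax
  obtain ⟨x₂, hx₂, hmax₂⟩ := h₂.exists_isMax
  have hM : 0 < max (ρ₁ x₁) (ρ₂ x₂) := by
    obtain ⟨x, hx, h | h⟩ := hne
    · exact lt_max_of_lt_left (((h₁.nonneg x).lt_of_ne' h).trans_le (hmax₁ x hx))
    · exact lt_max_of_lt_right (((h₂.nonneg x).lt_of_ne' h).trans_le (hmax₂ x hx))
  have hm := peak_pos hμ hω
  have hb : ∀ r, r ≤ max (ρ₁ x₁) (ρ₂ x₂) → peak μ ω / max (ρ₁ x₁) (ρ₂ x₂) * r ≤ peak μ ω := by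
    intro r hr
    rw [div_mul_eq_mul_div, div_le_iff₀ hM]
    exact mul_le_mul_of_nonneg_left hr hm.le
  refine ⟨peak μ ω / max (ρ₁ x₁) (ρ₂ x₂), div_pos hm hM,
    fun x hx ↦ hb _ ((hmax₁ x hx).trans (le_max_left _ _)),
    fun x hx ↦ hb _ ((hmax₂ x hx).trans (le_max_right _ _)), ?_⟩
  rcases max_choice (ρ₁ x₁) (ρ₂ x₂) with h | h
  · exact Or.inl ⟨x₁, hx₁, by rw [h] at hM ⊢; exact div_mul_cancel₀ _ hM.ne'⟩
  · exact Or.inr ⟨x₂, hx₂, by rw [h] at hM ⊢; exact div_mul_cancel₀ _ hM.ne'⟩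

theorem exists_le_of_bumpAction (hμ : 0 < μ) (hω : 0 < ω) (hκ : 0 < κ) (hκ1 : κ ≤ 1) {d : ℝ}
    (hd : ∀ y, 0 ≤ y → y ≤ peak μ ω → d ≤ bumpAction μ ω κ q y)
    (h₁ : IsProfile ρ₁ γ₁) (h₂ : IsProfile ρ₂ γ₂) (h0 : ρ₂ 0 = κ * ρ₁ 0)
    (hne : ∃ x, 0 ≤ x ∧ (ρ₁ x ≠ 0 ∨ ρ₂ x ≠ 0)) :
    ∃ t, 0 < t ∧ d ≤ profileAction μ ω (fun x ↦ t * ρ₁ x) (fun x ↦ t * γ₁ x)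
      + profileAction μ ω (fun x ↦ t * ρ₂ x) (fun x ↦ t * γ₂ x) - q / 2 * (t * ρ₁ 0) ^ 2 := by
  obtain ⟨t, ht, b₁, b₂, hp⟩ := exists_scaling hμ hω h₁ h₂ hne
  exact ⟨t, ht, (hd _ (mul_nonneg ht.le (h₁.nonneg 0)) (b₁ 0 le_rfl)).trans
    (bumpAction_le hμ hω hκ hκ1 (h₁.const_mul ht.le) (h₂.const_mul ht.le)
      (by simp only [h0]; ring) b₁ b₂ hp)⟩

theorem exists_le_of_tailAction (hμ : 0 < μ) (hω : 0 < ω) (hκ : 0 < κ) (hκ1 : κ ≤ 1) {x : ℝ}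
    (hx : 0 < x)
    (hd : ∀ y, 0 ≤ y → y ≤ x → tailAction μ ω κ q x ≤ bumpAction μ ω κ q y)
    (h₁ : IsProfile ρ₁ γ₁) (h₂ : IsProfile ρ₂ γ₂) (h0 : ρ₂ 0 = κ * ρ₁ 0)
    (hne : ∃ x, 0 ≤ x ∧ (ρ₁ x ≠ 0 ∨ ρ₂ x ≠ 0)) :
    ∃ t, 0 < t ∧ tailAction μ ω κ q x ≤
      profileAction μ ω (fun x ↦ t * ρ₁ x) (fun x ↦ t * γ₁ x)
      + profileAction μ ω (fun x ↦ t * ρ₂ x) (fun x ↦ t * γ₂ x) - q / 2 * (t * ρ₁ 0) ^ 2 := by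
  obtain ⟨t, ht, b₁, b₂, hp⟩ := exists_scaling hμ hω h₁ h₂ hne
  rcases le_or_gt (t * ρ₁ 0) x with hle | hlt
  · exact ⟨t, ht, (hd _ (mul_nonneg ht.le (h₁.nonneg 0)) hle).trans
      (bumpAction_le hμ hω hκ hκ1 (h₁.const_mul ht.le) (h₂.const_mul ht.le)
        (by simp only [h0]; ring) b₁ b₂ hp)⟩
  -- The hypothesis on `bumpAction` covers only boundary values up to `x`. The smaller factor giving
  -- boundary value exactly `x` keeps the profiles below the peak, so the tail bound applies.
  · have hρ : 0 < ρ₁ 0 := pos_of_mul_pos_right (hx.trans hlt) ht.le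
    have hs : 0 < x / ρ₁ 0 := div_pos hx hρ
    have hst : x / ρ₁ 0 ≤ t := by rw [div_le_iff₀ hρ]; exact hlt.le
    refine ⟨x / ρ₁ 0, hs, ?_⟩
    have hsx : x / ρ₁ 0 * ρ₁ 0 = x := div_mul_cancel₀ _ hρ.ne'
    have := tailAction_le (q := q) (κ := κ) hμ hω (h₁.const_mul hs.le) (h₂.const_mul hs.le)
      (by simp only [h0]; ring)
      (fun y hy ↦ (mul_le_mul_of_nonneg_right hst (h₁.nonneg y)).trans (b₁ y hy))
      (fun y hy ↦ (mul_le_mul_of_nonneg_right hst (h₂.nonneg y)).trans (b₂ y hy))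
    simp only [hsx] at this
    rw [hsx]
    exact this

end Profiles

/-! ### Solitons and equality in the lower bound. -/

/-- The soliton: the even positive solution, vanishing at infinity, of the stationary equation
`d²f/dx² = ω f - f^(2μ+1)`. -/
def soliton (μ ω x : ℝ) : ℝ := peak μ ω * Real.cosh (μ * √ω * x) ^ (-μ⁻¹)

/-- The derivative of the soliton. -/
def solitonDeriv (μ ω x : ℝ) : ℝ := -(√ω * Real.tanh (μ * √ω * x)) * soliton μ ω x

section Soliton

variable {μ ω : ℝ}

theorem soliton_pos (hμ : 0 < μ) (hω : 0 < ω) (x : ℝ) : 0 < soliton μ ω x :=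
  mul_pos (peak_pos hμ hω) (Real.rpow_pos_of_pos (Real.cosh_pos _) _)

theorem soliton_zero : soliton μ ω 0 = peak μ ω := by simp [soliton]

theorem soliton_neg (x : ℝ) : soliton μ ω (-x) = soliton μ ω x := by simp [soliton]

theorem solitonDeriv_neg (x : ℝ) : solitonDeriv μ ω (-x) = -solitonDeriv μ ω x := by
  simp [solitonDeriv, soliton_neg]

theorem hasDerivAt_soliton (hμ : 0 < μ) (x : ℝ) :
    HasDerivAt (soliton μ ω) (solitonDeriv μ ω x) x := by
  have h1 : HasDerivAt (fun x ↦ μ * √ω * x) (μ * √ω) x := by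
    simpa using (hasDerivAt_id x).const_mul (μ * √ω)
  have hc := Real.cosh_pos (μ * √ω * x)
  have h2 := ((h1.cosh).rpow_const (p := -μ⁻¹) (Or.inl hc.ne')).const_mul (peak μ ω)
  refine h2.congr_deriv ?_
  rw [solitonDeriv, soliton, Real.tanh_eq_sinh_div_cosh, Real.rpow_sub_one hc.ne']
  field_simp

theorem hasDerivAt_tanh (x : ℝ) : HasDerivAt Real.tanh (1 - Real.tanh x ^ 2) x := by
  have hc := (Real.cosh_pos x).ne'
  have h := (Real.hasDerivAt_sinh x).div (Real.hasDerivAt_cosh x) hc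
  have he : Real.tanh = Real.sinh / Real.cosh := funext Real.tanh_eq_sinh_div_cosh
  rw [he]
  refine h.congr_deriv ?_
  simp only [Pi.div_apply]
  field_simp

theorem tanh_sq_eq (x : ℝ) : Real.tanh x ^ 2 = 1 - (Real.cosh x ^ 2)⁻¹ := by
  have hc := (Real.cosh_pos x).ne'
  have := Real.cosh_sq x
  rw [Real.tanh_eq_sinh_div_cosh]
  field_simp
  linarith

theorem soliton_rpow (hμ : 0 < μ) (hω : 0 < ω) (x : ℝ) :
    soliton μ ω x ^ (2 * μ) = (μ + 1) * ω * (1 - Real.tanh (μ * √ω * x) ^ 2) := by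
  have hc := Real.cosh_pos (μ * √ω * x)
  rw [soliton, Real.mul_rpow (peak_pos hμ hω).le (Real.rpow_nonneg hc.le _), peak_rpow hμ hω,
    ← Real.rpow_mul hc.le, tanh_sq_eq, sub_sub_cancel]
  have : -μ⁻¹ * (2 * μ) = -2 := by field_simp
  rw [this, Real.rpow_neg hc.le, Real.rpow_two]

/-- The first-order equation on the decreasing half; `x ≥ 0` fixes the sign of the square root. -/
theorem theta_soliton (hμ : 0 < μ) (hω : 0 < ω) {x : ℝ} (hx : 0 ≤ x) :
    soliton μ ω x * theta μ ω (soliton μ ω x) = -solitonDeriv μ ω x := by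
  have hT : 0 ≤ Real.tanh (μ * √ω * x) := by
    rw [Real.tanh_eq_sinh_div_cosh]
    exact div_nonneg (Real.sinh_nonneg_iff.2 (by positivity)) (Real.cosh_pos _).le
  have : theta μ ω (soliton μ ω x) = √ω * Real.tanh (μ * √ω * x) := by
    rw [theta, soliton_rpow hμ hω]
    have e : ω - (μ + 1) * ω * (1 - Real.tanh (μ * √ω * x) ^ 2) / (μ + 1)
        = ω * Real.tanh (μ * √ω * x) ^ 2 := by
      field_simp
      ring
    rw [e, Real.sqrt_mul hω.le, Real.sqrt_sq hT]
  rw [this, solitonDeriv]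
  ring

theorem soliton_rpow_add_two (hμ : 0 < μ) (hω : 0 < ω) (x : ℝ) :
    soliton μ ω x ^ (2 * μ + 2)
      = (μ + 1) * ω * (1 - Real.tanh (μ * √ω * x) ^ 2) * soliton μ ω x ^ 2 := by
  rw [Real.rpow_add (soliton_pos hμ hω x), soliton_rpow hμ hω, Real.rpow_two]

theorem solitonDeriv_sq (hμ : 0 < μ) (hω : 0 < ω) (x : ℝ) :
    solitonDeriv μ ω x ^ 2
      = ω * soliton μ ω x ^ 2 - soliton μ ω x ^ (2 * μ + 2) / (μ + 1) := by
  rw [soliton_rpow_add_two hμ hω, solitonDeriv, mul_pow, neg_sq, mul_pow, Real.sq_sqrt hω.le]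
  field_simp
  ring

theorem continuous_soliton (hμ : 0 < μ) : Continuous (soliton μ ω) :=
  continuous_iff_continuousAt.2 fun x ↦ (hasDerivAt_soliton hμ x).continuousAt

theorem continuous_tanh : Continuous Real.tanh :=
  continuous_iff_continuousAt.2 fun x ↦ (hasDerivAt_tanh x).continuousAt

theorem continuous_solitonDeriv (hμ : 0 < μ) : Continuous (solitonDeriv μ ω) := by
  have h1 := continuous_tanh
  have h2 := continuous_soliton (ω := ω) hμ
  unfold solitonDeriv
  fun_prop

/-- The derivative is the Nehari density, so the Nehari functional of a shifted soliton is a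
boundary term. -/
theorem hasDerivAt_soliton_mul_solitonDeriv (hμ : 0 < μ) (hω : 0 < ω) (x : ℝ) :
    HasDerivAt (fun x ↦ soliton μ ω x * solitonDeriv μ ω x)
      (solitonDeriv μ ω x ^ 2 + ω * soliton μ ω x ^ 2 - soliton μ ω x ^ (2 * μ + 2)) x := by
  have h1 : HasDerivAt (fun x ↦ μ * √ω * x) (μ * √ω) x := by
    simpa using (hasDerivAt_id x).const_mul (μ * √ω)
  have h2 := (hasDerivAt_tanh (μ * √ω * x)).comp x h1
  have h3 := ((h2.const_mul (√ω)).neg).mul (hasDerivAt_soliton (ω := ω) hμ x)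
  have h4 := (hasDerivAt_soliton (ω := ω) hμ x).mul h3
  refine h4.congr_deriv ?_
  rw [soliton_rpow_add_two hμ hω]
  simp only [Function.comp_apply, Pi.mul_apply, Pi.neg_apply, solitonDeriv]
  have hs := Real.sq_sqrt hω.le
  generalize Real.tanh (μ * √ω * x) = T
  generalize soliton μ ω x = f
  generalize √ω = s at hs ⊢
  rw [← hs]
  ring

theorem abs_solitonDeriv_le (hμ : 0 < μ) (hω : 0 < ω) (x : ℝ) :
    |solitonDeriv μ ω x| ≤ √ω * soliton μ ω x := by
  rw [solitonDeriv, abs_mul, abs_neg, abs_mul, abs_of_pos (soliton_pos hμ hω x),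
    abs_of_nonneg (Real.sqrt_nonneg ω)]
  have hT : |Real.tanh (μ * √ω * x)| ≤ 1 := by
    rw [← sq_le_one_iff_abs_le_one, tanh_sq_eq]
    have : 0 ≤ (Real.cosh (μ * √ω * x) ^ 2)⁻¹ := by positivity
    linarith
  have := soliton_pos hμ hω x
  have := Real.sqrt_nonneg ω
  gcongr
  exact mul_le_of_le_one_right ‹_› hT

theorem soliton_le_exp (hμ : 0 < μ) (hω : 0 < ω) (x : ℝ) :
    soliton μ ω x ≤ peak μ ω * 2 ^ μ⁻¹ * Real.exp (-√ω * x) := by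
  have hc : Real.exp (μ * √ω * x) / 2 ≤ Real.cosh (μ * √ω * x) := by
    rw [Real.cosh_eq]
    have := Real.exp_pos (-(μ * √ω * x))
    linarith
  rw [soliton, mul_assoc (peak μ ω)]
  refine mul_le_mul_of_nonneg_left ?_ (peak_pos hμ hω).le
  refine (Real.rpow_le_rpow_of_nonpos (by positivity) hc (by simpa using hμ.le)).trans_eq ?_
  rw [Real.div_rpow (Real.exp_pos _).le (by norm_num), ← Real.exp_mul, Real.rpow_neg (by norm_num),
    div_inv_eq_mul, mul_comm]
  congr 2
  field_simp

theorem tendsto_soliton (hμ : 0 < μ) (hω : 0 < ω) : Tendsto (soliton μ ω) atTop (𝓝 0) := by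
  have h : Tendsto (fun x ↦ peak μ ω * 2 ^ μ⁻¹ * Real.exp (-√ω * x)) atTop (𝓝 0) := by
    have h1 : Tendsto (fun x ↦ -√ω * x) atTop atBot :=
      tendsto_id.const_mul_atTop_of_neg (by simpa using hω)
    simpa using (Real.tendsto_exp_atBot.comp h1).const_mul (peak μ ω * 2 ^ μ⁻¹)
  exact squeeze_zero (fun x ↦ (soliton_pos hμ hω x).le) (soliton_le_exp hμ hω) h

theorem memLp_soliton (hμ : 0 < μ) (hω : 0 < ω) (a : ℝ) :
    MemLp (fun x ↦ soliton μ ω (x + a)) 2 (volume.restrict (Ioi 0)) := by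
  have hs := continuous_soliton (ω := ω) hμ
  have hc : Continuous fun x ↦ soliton μ ω (x + a) := by fun_prop
  rw [memLp_two_iff_integrable_sq hc.aestronglyMeasurable]
  have hi : IntegrableOn (fun x ↦ (peak μ ω * 2 ^ μ⁻¹ * Real.exp (-√ω * a)) ^ 2
      * Real.exp (-(2 * √ω) * x)) (Ioi 0) :=
    (integrableOn_exp_mul_Ioi (by simpa using hω) 0).const_mul _
  refine Integrable.mono' hi (hc.pow 2).aestronglyMeasurable (Eventually.of_forall fun x ↦ ?_)
  rw [Real.norm_of_nonneg (by positivity)]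
  refine (pow_le_pow_left₀ (soliton_pos hμ hω _).le (soliton_le_exp hμ hω (x + a)) 2).trans_eq ?_
  have : Real.exp (-(2 * √ω) * x) = Real.exp (-√ω * x) ^ 2 := by
    rw [← Real.exp_nat_mul]; congr 1; push_cast; ring
  rw [this, mul_add, Real.exp_add]
  ring

theorem hasDerivAt_soliton_add (hμ : 0 < μ) (a x : ℝ) :
    HasDerivAt (fun x ↦ soliton μ ω (x + a)) (solitonDeriv μ ω (x + a)) x :=
  (hasDerivAt_soliton hμ (x + a)).comp_add_const x a

theorem isProfile_soliton (hμ : 0 < μ) (hω : 0 < ω) (a : ℝ) :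
    IsProfile (fun x ↦ soliton μ ω (x + a)) (fun x ↦ |solitonDeriv μ ω (x + a)|) where
  nonneg x := (soliton_pos hμ hω _).le
  slope_nonneg x := abs_nonneg _
  memLp := memLp_soliton hμ hω a
  memLp_slope := by
    have hs := continuous_solitonDeriv (ω := ω) hμ
    refine ((memLp_soliton hμ hω a).const_mul (√ω)).mono
      (by fun_prop : Continuous _).aestronglyMeasurable (Eventually.of_forall fun x ↦ ?_)
    rw [Real.norm_eq_abs, abs_abs]
    exact (abs_solitonDeriv_le hμ hω _).trans (le_abs_self _)
  abs_sub_le x y _ hxy := by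
    have hs := continuous_solitonDeriv (ω := ω) hμ
    have hc : Continuous fun x ↦ solitonDeriv μ ω (x + a) := by fun_prop
    rw [← intervalIntegral.integral_eq_sub_of_hasDerivAt
      (fun t _ ↦ hasDerivAt_soliton_add hμ a t) (hc.intervalIntegrable _ _)]
    exact intervalIntegral.abs_integral_le_integral_abs hxy

/-- The Nehari functional of a half-line profile, without the boundary term. -/
def profileNehari (μ ω : ℝ) (ρ γ : ℝ → ℝ) : ℝ :=
  (∫ x in Ioi 0, γ x ^ 2) + ω * (∫ x in Ioi 0, ρ x ^ 2) - ∫ x in Ioi 0, ρ x ^ (2 * μ + 2)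

theorem tendsto_soliton_add (hμ : 0 < μ) (hω : 0 < ω) (a : ℝ) :
    Tendsto (fun x ↦ soliton μ ω (x + a)) atTop (𝓝 0) :=
  (tendsto_soliton hμ hω).comp (tendsto_atTop_add_const_right _ a tendsto_id)

theorem profileNehari_soliton (hμ : 0 < μ) (hω : 0 < ω) (a : ℝ) :
    profileNehari μ ω (fun x ↦ soliton μ ω (x + a)) (fun x ↦ |solitonDeriv μ ω (x + a)|)
      = -(soliton μ ω a * solitonDeriv μ ω a) := by
  have hp := isProfile_soliton hμ hω a
  have i1 := hp.integrableOn_slope_sq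
  have i2 := hp.integrableOn_sq.const_mul ω
  have i3 := hp.integrableOn_rpow hμ
  have i12 : IntegrableOn (fun x ↦ |solitonDeriv μ ω (x + a)| ^ 2 + ω * soliton μ ω (x + a) ^ 2)
    (Ioi 0) := i1.add i2
  rw [profileNehari, ← integral_const_mul, ← integral_add i1 i2, ← integral_sub i12 i3]
  have i123 : IntegrableOn (fun x ↦ |solitonDeriv μ ω (x + a)| ^ 2 + ω * soliton μ ω (x + a) ^ 2
    - soliton μ ω (x + a) ^ (2 * μ + 2)) (Ioi 0) := i12.sub i3
  have ht : Tendsto (fun x ↦ soliton μ ω (x + a) * solitonDeriv μ ω (x + a)) atTop (𝓝 0) := by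
    have h1 := (tendsto_soliton_add hμ hω a)
    refine squeeze_zero_norm (a := fun x ↦ √ω * (soliton μ ω (x + a) * soliton μ ω (x + a)))
      (fun x ↦ ?_) (by simpa using (h1.mul h1).const_mul (√ω))
    rw [norm_mul, Real.norm_of_nonneg (soliton_pos hμ hω _).le, Real.norm_eq_abs]
    have := mul_le_mul_of_nonneg_left (abs_solitonDeriv_le hμ hω (x + a))
      (soliton_pos hμ hω (x + a)).le
    linarith
  have := integral_Ioi_of_hasDerivAt_of_tendsto' (a := 0)
    (fun x _ ↦ (hasDerivAt_soliton_mul_solitonDeriv hμ hω (x + a)).comp_add_const x a)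
    (by simpa only [sq_abs] using i123) ht
  simp only [sq_abs]
  rw [this, zero_add, zero_sub]

/-- The first integral `solitonDeriv_sq` makes the kinetic and potential parts of the action equal.
-/
theorem profileAction_soliton_eq_integral (hμ : 0 < μ) (hω : 0 < ω) (a : ℝ) :
    profileAction μ ω (fun x ↦ soliton μ ω (x + a)) (fun x ↦ |solitonDeriv μ ω (x + a)|)
      = ∫ x in Ioi 0, solitonDeriv μ ω (x + a) ^ 2 := by
  have hp := isProfile_soliton hμ hω a
  have i1 := hp.integrableOn_slope_sq.const_mul (1 / 2)
  have i2 := hp.integrableOn_sq.const_mul (ω / 2)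
  have i3 := (hp.integrableOn_rpow hμ).const_mul (1 / (2 * μ + 2))
  have i12 : IntegrableOn (fun x ↦ 1 / 2 * |solitonDeriv μ ω (x + a)| ^ 2
    + ω / 2 * soliton μ ω (x + a) ^ 2) (Ioi 0) := i1.add i2
  rw [profileAction, ← integral_const_mul, ← integral_const_mul, ← integral_const_mul,
    ← integral_add i1 i2, ← integral_sub i12 i3]
  refine integral_congr_ae (Eventually.of_forall fun x ↦ ?_)
  have := solitonDeriv_sq hμ hω (x + a)
  simp only [sq_abs]
  have e : 1 / (2 * μ + 2) * soliton μ ω (x + a) ^ (2 * μ + 2)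
      = 1 / 2 * (soliton μ ω (x + a) ^ (2 * μ + 2) / (μ + 1)) := by
    field_simp
  rw [e]
  linarith

theorem hasDerivAt_monotoneAction_soliton (hμ : 0 < μ) (hω : 0 < ω) {x : ℝ} (hx : 0 ≤ x) :
    HasDerivAt (fun x ↦ monotoneAction μ ω (soliton μ ω x)) (-solitonDeriv μ ω x ^ 2) x := by
  have h := (hasDerivAt_monotoneAction hμ ω (soliton μ ω x)).comp x (hasDerivAt_soliton hμ x)
  rw [theta_soliton hμ hω hx] at h
  refine h.congr_deriv ?_
  ring

theorem integrableOn_solitonDeriv_sq (hμ : 0 < μ) (hω : 0 < ω) (a : ℝ) :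
    IntegrableOn (fun x ↦ solitonDeriv μ ω (x + a) ^ 2) (Ioi 0) := by
  simpa only [sq_abs] using (isProfile_soliton hμ hω a).integrableOn_slope_sq

theorem setIntegral_Ioi_solitonDeriv_sq (hμ : 0 < μ) (hω : 0 < ω) {a c : ℝ} (hc : 0 ≤ c)
    (hca : 0 ≤ c + a) : ∫ x in Ioi c, solitonDeriv μ ω (x + a) ^ 2
      = monotoneAction μ ω (soliton μ ω (c + a)) := by
  have ht : Tendsto (fun x ↦ monotoneAction μ ω (soliton μ ω (x + a))) atTop (𝓝 0) := by
    have := ((continuous_monotoneAction hμ ω).tendsto 0).comp (tendsto_soliton_add hμ hω a)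
    rwa [monotoneAction_zero] at this
  have := integral_Ioi_of_hasDerivAt_of_tendsto' (a := c)
    (fun x hx ↦ (hasDerivAt_monotoneAction_soliton hμ hω
      (hca.trans (add_le_add_left (mem_Ici.1 hx) a))).comp_add_const x a)
    ((integrableOn_solitonDeriv_sq hμ hω a).mono_set (Ioi_subset_Ioi hc)).neg ht
  rw [integral_neg, zero_sub, neg_inj] at this
  exact this

theorem profileAction_soliton (hμ : 0 < μ) (hω : 0 < ω) {a : ℝ} (ha : 0 ≤ a) :
    profileAction μ ω (fun x ↦ soliton μ ω (x + a)) (fun x ↦ |solitonDeriv μ ω (x + a)|)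
      = monotoneAction μ ω (soliton μ ω a) := by
  rw [profileAction_soliton_eq_integral hμ hω,
    setIntegral_Ioi_solitonDeriv_sq hμ hω le_rfl (by linarith), zero_add]

theorem profileAction_soliton_neg (hμ : 0 < μ) (hω : 0 < ω) {a : ℝ} (ha : 0 ≤ a) :
    profileAction μ ω (fun x ↦ soliton μ ω (x + -a)) (fun x ↦ |solitonDeriv μ ω (x + -a)|)
      = 2 * monotoneAction μ ω (peak μ ω) - monotoneAction μ ω (soliton μ ω a) := by
  have hi := integrableOn_solitonDeriv_sq hμ hω (-a)
  have hs := continuous_solitonDeriv (ω := ω) hμ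
  rw [profileAction_soliton_eq_integral hμ hω,
    ← intervalIntegral.integral_interval_add_Ioi hi (hi.mono_set (Ioi_subset_Ioi ha)),
    setIntegral_Ioi_solitonDeriv_sq hμ hω ha (by linarith), add_neg_cancel, soliton_zero]
  have h2 : ∫ x in (0 : ℝ)..a, solitonDeriv μ ω (x + -a) ^ 2
      = monotoneAction μ ω (peak μ ω) - monotoneAction μ ω (soliton μ ω a) := by
    -- The soliton is centred at `a`; reflecting its rising piece on `[0, a]` gives the decreasing
    -- half, where the first-order equation holds.
    have e : ∀ x, solitonDeriv μ ω (x + -a) ^ 2 = solitonDeriv μ ω (a - x) ^ 2 := fun x ↦ by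
      rw [show x + -a = -(a - x) by ring, solitonDeriv_neg, neg_sq]
    simp only [e]
    rw [intervalIntegral.integral_comp_sub_left (fun x ↦ solitonDeriv μ ω x ^ 2), sub_self,
      sub_zero]
    have hc : Continuous fun x ↦ -solitonDeriv μ ω x ^ 2 := by fun_prop
    have h3 := intervalIntegral.integral_eq_sub_of_hasDerivAt (a := 0) (b := a)
      (fun x hx ↦ hasDerivAt_monotoneAction_soliton hμ hω
        (by rw [uIcc_of_le ha] at hx; exact hx.1)) (hc.intervalIntegrable _ _)
    rw [intervalIntegral.integral_neg, soliton_zero] at h3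
    linarith
  rw [h2]
  ring

theorem exists_soliton_eq (hμ : 0 < μ) (hω : 0 < ω) {x : ℝ} (hx : 0 < x) (hxm : x ≤ peak μ ω) :
    ∃ a, 0 ≤ a ∧ soliton μ ω a = x := by
  obtain ⟨R, hR⟩ := eventually_atTop.1 ((tendsto_soliton hμ hω).eventually (gt_mem_nhds hx))
  have h0 : (0 : ℝ) ≤ max 0 R := le_max_left _ _
  obtain ⟨a, ha, hax⟩ := intermediate_value_Icc' h0 (continuous_soliton (ω := ω) hμ).continuousOn
    (show x ∈ _ from ⟨(hR _ (le_max_right 0 R)).le, by rwa [soliton_zero]⟩)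
  exact ⟨a, ha.1, hax⟩

theorem profileNehari_soliton_of_nonneg (hμ : 0 < μ) (hω : 0 < ω) {a : ℝ} (ha : 0 ≤ a) :
    profileNehari μ ω (fun x ↦ soliton μ ω (x + a)) (fun x ↦ |solitonDeriv μ ω (x + a)|)
      = theta μ ω (soliton μ ω a) * soliton μ ω a ^ 2 := by
  rw [profileNehari_soliton hμ hω, ← mul_neg, ← theta_soliton hμ hω ha]
  ring

theorem profileNehari_soliton_neg (hμ : 0 < μ) (hω : 0 < ω) {a : ℝ} (ha : 0 ≤ a) :
    profileNehari μ ω (fun x ↦ soliton μ ω (x + -a)) (fun x ↦ |solitonDeriv μ ω (x + -a)|)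
      = -theta μ ω (soliton μ ω a) * soliton μ ω a ^ 2 := by
  rw [profileNehari_soliton hμ hω, soliton_neg, solitonDeriv_neg, ← theta_soliton hμ hω ha]
  ring

end Soliton

/-! ### Optimality of glued solitons among profiles. -/

section Optimal

variable {μ ω κ q : ℝ}

theorem profileAction_const_mul {ρ γ : ℝ → ℝ} (hρ : ∀ x, 0 ≤ ρ x) {t : ℝ} (ht : 0 ≤ t) :
    profileAction μ ω (fun x ↦ t * ρ x) (fun x ↦ t * γ x)
      = t ^ 2 / 2 * (∫ x in Ioi 0, γ x ^ 2) + t ^ 2 / 2 * (ω * ∫ x in Ioi 0, ρ x ^ 2)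
        - t ^ (2 * μ + 2) / (2 * μ + 2) * ∫ x in Ioi 0, ρ x ^ (2 * μ + 2) := by
  simp only [profileAction, mul_pow, Real.mul_rpow ht (hρ _), integral_const_mul]
  ring

/-- Bernoulli's inequality for `t²` with exponent `μ + 1`. -/
theorem action_scaling_le (hμ : 0 < μ) {t : ℝ} (ht : 0 ≤ t) :
    t ^ 2 / 2 - t ^ (2 * μ + 2) / (2 * μ + 2) ≤ 1 / 2 - 1 / (2 * μ + 2) := by
  have h := one_add_mul_self_le_rpow_one_add (s := t ^ 2 - 1) (by nlinarith [sq_nonneg t])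
    (p := μ + 1) (by linarith)
  have e : (1 + (t ^ 2 - 1)) ^ (μ + 1) = t ^ (2 * μ + 2) := by
    rw [add_sub_cancel, ← Real.rpow_two, ← Real.rpow_mul ht]
    ring_nf
  rw [e] at h
  have h2 : (1 + (μ + 1) * (t ^ 2 - 1)) / (2 * μ + 2) ≤ t ^ (2 * μ + 2) / (2 * μ + 2) := by
    gcongr
  have h3 : (1 + (μ + 1) * (t ^ 2 - 1)) / (2 * μ + 2) = 1 / (2 * μ + 2) + (t ^ 2 - 1) / 2 := by
    field_simp
  linarith

/-- On the Nehari manifold the action is maximal along rays. -/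
theorem action_ray_le (hμ : 0 < μ) {ρ₁ γ₁ ρ₂ γ₂ : ℝ → ℝ}
    (h₁ : IsProfile ρ₁ γ₁) (h₂ : IsProfile ρ₂ γ₂)
    (hN : profileNehari μ ω ρ₁ γ₁ + profileNehari μ ω ρ₂ γ₂ - q * ρ₁ 0 ^ 2 = 0)
    {t : ℝ} (ht : 0 ≤ t) :
    profileAction μ ω (fun x ↦ t * ρ₁ x) (fun x ↦ t * γ₁ x)
      + profileAction μ ω (fun x ↦ t * ρ₂ x) (fun x ↦ t * γ₂ x) - q / 2 * (t * ρ₁ 0) ^ 2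
    ≤ profileAction μ ω ρ₁ γ₁ + profileAction μ ω ρ₂ γ₂ - q / 2 * ρ₁ 0 ^ 2 := by
  rw [profileAction_const_mul h₁.nonneg ht, profileAction_const_mul h₂.nonneg ht]
  unfold profileNehari at hN
  unfold profileAction
  have p1 : 0 ≤ ∫ x in Ioi 0, ρ₁ x ^ (2 * μ + 2) :=
    integral_nonneg fun x ↦ Real.rpow_nonneg (h₁.nonneg x) _
  have p2 : 0 ≤ ∫ x in Ioi 0, ρ₂ x ^ (2 * μ + 2) :=
    integral_nonneg fun x ↦ Real.rpow_nonneg (h₂.nonneg x) _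
  generalize (∫ x in Ioi 0, ρ₁ x ^ (2 * μ + 2)) = P₁ at *
  generalize (∫ x in Ioi 0, ρ₂ x ^ (2 * μ + 2)) = P₂ at *
  generalize (∫ x in Ioi 0, ρ₁ x ^ 2) = N₁ at *
  generalize (∫ x in Ioi 0, ρ₂ x ^ 2) = N₂ at *
  generalize (∫ x in Ioi 0, γ₁ x ^ 2) = D₁ at *
  generalize (∫ x in Ioi 0, γ₂ x ^ 2) = D₂ at *
  have hk := mul_le_mul_of_nonneg_right (action_scaling_le hμ ht) (add_nonneg p1 p2)
  -- The constraint equates the quadratic part with the power term, so the action at `t` is `t²/2 -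
  -- t^(2μ+2)/(2μ+2)` times `P₁ + P₂`.
  have e1 : D₁ + ω * N₁ + (D₂ + ω * N₂) - q * ρ₁ 0 ^ 2 = P₁ + P₂ := by linarith
  have e2 : t ^ 2 / 2 * D₁ + t ^ 2 / 2 * (ω * N₁) - t ^ (2 * μ + 2) / (2 * μ + 2) * P₁
      + (t ^ 2 / 2 * D₂ + t ^ 2 / 2 * (ω * N₂) - t ^ (2 * μ + 2) / (2 * μ + 2) * P₂)
      - q / 2 * (t * ρ₁ 0) ^ 2
      = t ^ 2 / 2 * (D₁ + ω * N₁ + (D₂ + ω * N₂) - q * ρ₁ 0 ^ 2)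
        - t ^ (2 * μ + 2) / (2 * μ + 2) * (P₁ + P₂) := by ring
  have e3 : 1 / 2 * D₁ + ω / 2 * N₁ - 1 / (2 * μ + 2) * P₁
      + (1 / 2 * D₂ + ω / 2 * N₂ - 1 / (2 * μ + 2) * P₂) - q / 2 * ρ₁ 0 ^ 2
      = 1 / 2 * (D₁ + ω * N₁ + (D₂ + ω * N₂) - q * ρ₁ 0 ^ 2) - 1 / (2 * μ + 2) * (P₁ + P₂) := by
    ring
  rw [e2, e3, e1]
  linarith

theorem exists_optimal_solitons (hμ : 0 < μ) (hω : 0 < ω) (hκ : 0 < κ) (hκ1 : κ ≤ 1)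
    (hq : 0 < q) (hqω : q < (1 + κ ^ 2) * √ω) :
    ∃ a₁ a₂ : ℝ, soliton μ ω a₂ = κ * soliton μ ω a₁ ∧
      profileNehari μ ω (fun x ↦ soliton μ ω (x + a₁)) (fun x ↦ |solitonDeriv μ ω (x + a₁)|)
        + profileNehari μ ω (fun x ↦ soliton μ ω (x + a₂)) (fun x ↦ |solitonDeriv μ ω (x + a₂)|)
        - q * soliton μ ω a₁ ^ 2 = 0 ∧
      ∀ ρ₁ γ₁ ρ₂ γ₂ : ℝ → ℝ, IsProfile ρ₁ γ₁ → IsProfile ρ₂ γ₂ → ρ₂ 0 = κ * ρ₁ 0 →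
        (∃ x, 0 ≤ x ∧ (ρ₁ x ≠ 0 ∨ ρ₂ x ≠ 0)) →
        profileNehari μ ω ρ₁ γ₁ + profileNehari μ ω ρ₂ γ₂ - q * ρ₁ 0 ^ 2 = 0 →
        profileAction μ ω (fun x ↦ soliton μ ω (x + a₁)) (fun x ↦ |solitonDeriv μ ω (x + a₁)|)
        + profileAction μ ω (fun x ↦ soliton μ ω (x + a₂)) (fun x ↦ |solitonDeriv μ ω (x + a₂)|)
        - q / 2 * soliton μ ω a₁ ^ 2
        ≤ profileAction μ ω ρ₁ γ₁ + profileAction μ ω ρ₂ γ₂ - q / 2 * ρ₁ 0 ^ 2 := by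
  obtain ⟨x, hx, hxm, hcase⟩ := exists_critical hμ hω hκ hκ1 hq hqω
  obtain ⟨a, ha, hax⟩ := exists_soliton_eq hμ hω hx hxm
  obtain ⟨b, hb, hbx⟩ := exists_soliton_eq hμ hω (mul_pos hκ hx)
    ((mul_le_of_le_one_left hx.le hκ1).trans hxm)
  rcases hcase with ⟨hcrit, hmin⟩ | ⟨hcrit, hmin⟩
  · refine ⟨a, b, by rw [hax, hbx], ?_, fun ρ₁ γ₁ ρ₂ γ₂ h₁ h₂ h0 hne hN ↦ ?_⟩
    · rw [profileNehari_soliton_of_nonneg hμ hω ha, profileNehari_soliton_of_nonneg hμ hω hb,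
        hax, hbx, ← hcrit]
      ring
    · rw [profileAction_soliton hμ hω ha, profileAction_soliton hμ hω hb, hax, hbx]
      obtain ⟨t, ht, hle⟩ := exists_le_of_tailAction hμ hω hκ hκ1 hx hmin h₁ h₂ h0 hne
      exact hle.trans (action_ray_le hμ h₁ h₂ hN ht.le)
  -- The negative shift places the peak at `a ≥ 0` in the first half-line and turns `θ(x)` into
  -- `-θ(x)` in the Nehari sum.
  · refine ⟨-a, b, by rw [soliton_neg, hax, hbx], ?_, fun ρ₁ γ₁ ρ₂ γ₂ h₁ h₂ h0 hne hN ↦ ?_⟩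
    · rw [profileNehari_soliton_neg hμ hω ha, profileNehari_soliton_of_nonneg hμ hω hb,
        soliton_neg, hax, hbx, ← hcrit]
      ring
    · rw [profileAction_soliton_neg hμ hω ha, profileAction_soliton hμ hω hb, soliton_neg,
        hax, hbx]
      obtain ⟨t, ht, hle⟩ := exists_le_of_bumpAction hμ hω hκ hκ1 hmin h₁ h₂ h0 hne
      exact hle.trans (action_ray_le hμ h₁ h₂ hN ht.le)

end Optimal

/-! ### Passage between the energy space and profiles. -/

section Reflection

variable {Ω : Set ℝ} {f : ℝ → ℂ}

theorem MemH1.comp_neg (hΩ : IsOpen Ω) (h : MemH1 Ω f) :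
    MemH1 (Neg.neg ⁻¹' Ω) (fun x ↦ f (-x)) := by
  obtain ⟨h1, g, hg, hw⟩ := h
  have hmp := (Measure.measurePreserving_neg (volume : Measure ℝ)).restrict_preimage
    hΩ.measurableSet
  exact ⟨h1.comp_measurePreserving hmp, _, (hg.comp_measurePreserving hmp).neg, hw.comp_neg hΩ⟩

theorem MemH1.hasWeakDerivOn_weakDeriv (h : MemH1 Ω f) :
    HasWeakDerivOn Ω f (weakDeriv Ω f) := by
  obtain ⟨-, g, -, hw⟩ := h
  have hex : ∃ g, HasWeakDerivOn Ω f g := ⟨g, hw⟩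
  rw [weakDeriv, dif_pos hex]
  exact hex.choose_spec

theorem weakDeriv_comp_neg (hΩ : IsOpen Ω) (h : MemH1 Ω f) :
    ∀ᵐ x ∂volume.restrict (Neg.neg ⁻¹' Ω),
      weakDeriv (Neg.neg ⁻¹' Ω) (fun x ↦ f (-x)) x = -weakDeriv Ω f (-x) :=
  weakDeriv_ae_eq (hΩ.preimage continuous_neg) (h.hasWeakDerivOn_weakDeriv.comp_neg hΩ)

theorem HasBoundaryValue.comp_neg (hΩ : IsOpen Ω) {p : ℝ} {c : ℂ} (h : HasBoundaryValue Ω f p c) :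
    HasBoundaryValue (Neg.neg ⁻¹' Ω) (fun x ↦ f (-x)) (-p) c := by
  obtain ⟨w, h1, h2, h3⟩ := h
  have hmp := (Measure.measurePreserving_neg (volume : Measure ℝ)).restrict_preimage
    hΩ.measurableSet
  refine ⟨fun x ↦ w (-x), h1.comp continuous_neg.continuousOn
    (continuous_neg.closure_preimage_subset Ω), hmp.quasiMeasurePreserving.ae_eq h2, ?_⟩
  simpa using h3

end Reflection

/-- With `f` written as a primitive of `g`, the moduli of the primitive and of `g` form a profile by
the reverse triangle inequality; the modulus need not be differentiated. -/
theorem exists_hasBoundaryValue_isProfile {f : ℝ → ℂ} (h : MemH1 (Ioi 0) f) :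
    ∃ (c : ℂ) (ρ γ : ℝ → ℝ), HasBoundaryValue (Ioi 0) f 0 c ∧ IsProfile ρ γ ∧ ρ 0 = ‖c‖ ∧
      (∀ᵐ x ∂volume.restrict (Ioi 0), ‖f x‖ = ρ x) ∧
      ∀ᵐ x ∂volume.restrict (Ioi 0), ‖weakDeriv (Ioi 0) f x‖ = γ x := by
  obtain ⟨hf, g, hg, hw⟩ := h
  obtain ⟨c, hc⟩ := hw.exists_ae_eq_primitive hg
  have hae : ∀ᵐ x ∂volume.restrict (Ioi 0), ‖f x‖ = ‖c + ∫ t in (0 : ℝ)..x, g t‖ := by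
    filter_upwards [hc] with x hx
    rw [hx]
  refine ⟨c, fun x ↦ ‖c + ∫ t in (0 : ℝ)..x, g t‖, fun x ↦ ‖g x‖,
    ⟨fun x ↦ c + ∫ t in (0 : ℝ)..x, g t, ?_, ?_, ?_⟩,
    ⟨fun x ↦ norm_nonneg _, fun x ↦ norm_nonneg _, ?_, hg.norm, fun x y hx hxy ↦ ?_⟩, by simp,
    hae, ?_⟩
  · rw [closure_Ioi]
    exact continuousOn_primitive_Ici hg c
  · filter_upwards [hc] with x hx
    rw [hx]
  · simp
  · exact hf.norm.ae_eq hae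
  · refine (abs_norm_sub_norm_le _ _).trans ?_
    rw [add_sub_add_left_eq_sub, intervalIntegral.integral_interval_sub_left
      (intervalIntegrable_of_memLp_Ioi hg le_rfl (hx.trans hxy))
      (intervalIntegrable_of_memLp_Ioi hg le_rfl hx)]
    exact intervalIntegral.norm_integral_le_integral_norm hxy
  · filter_upwards [weakDeriv_ae_eq isOpen_Ioi hw] with x hx
    rw [hx]

/-- The profiles of `u` on the two half-lines. -/
structure HasProfiles (u : Lp ℂ 2 (volume : Measure ℝ)) (ρl γl ρr γr : ℝ → ℝ) : Prop where
  left : IsProfile ρl γl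
  right : IsProfile ρr γr
  norm_left : ∀ᵐ x ∂volume.restrict (Ioi 0), ‖u (-x)‖ = ρl x
  norm_right : ∀ᵐ x ∂volume.restrict (Ioi 0), ‖u x‖ = ρr x
  norm_deriv_left : ∀ᵐ x ∂volume.restrict (Ioi 0), ‖weakDeriv (Iio 0) u (-x)‖ = γl x
  norm_deriv_right : ∀ᵐ x ∂volume.restrict (Ioi 0), ‖weakDeriv (Ioi 0) u x‖ = γr x
  norm_leftTrace : ‖leftTrace u‖ = ρl 0
  norm_rightTrace : ‖rightTrace u‖ = ρr 0

theorem exists_hasProfiles {u : Lp ℂ 2 (volume : Measure ℝ)} (hl : MemH1 (Iio 0) u)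
    (hr : MemH1 (Ioi 0) u) : ∃ ρl γl ρr γr, HasProfiles u ρl γl ρr γr := by
  have hpre : Neg.neg ⁻¹' (Iio (0 : ℝ)) = Ioi 0 := by simp
  have hpre' : Neg.neg ⁻¹' (Ioi (0 : ℝ)) = Iio 0 := by simp
  have hl' := hl.comp_neg isOpen_Iio
  have hwl := weakDeriv_comp_neg isOpen_Iio hl
  rw [hpre] at hl' hwl
  obtain ⟨c, ρl, γl, b1, b2, b3, b4, b5⟩ := exists_hasBoundaryValue_isProfile hl'
  obtain ⟨d, ρr, γr, d1, d2, d3, d4, d5⟩ := exists_hasBoundaryValue_isProfile hr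
  have b6 := b1.comp_neg isOpen_Ioi
  rw [hpre'] at b6
  simp only [neg_neg, neg_zero] at b6
  refine ⟨ρl, γl, ρr, γr, b2, d2, b4, d4, ?_, d5, ?_, ?_⟩
  · filter_upwards [hwl, b5] with x h1 h2
    rw [← h2, h1, norm_neg]
  · rw [b3, leftTrace, boundaryValue_eq isOpen_Iio (by simp) b6]
  · rw [d3, rightTrace, boundaryValue_eq isOpen_Ioi (by simp) d1]

theorem setIntegral_Iio_eq (F : ℝ → ℝ) : ∫ x in Iio 0, F x = ∫ x in Ioi 0, F (-x) := by
  rw [integral_comp_neg_Ioi, neg_zero, integral_Iic_eq_integral_Iio]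

theorem integrableOn_Iic_of_comp_neg {F : ℝ → ℝ} (h : IntegrableOn (fun x ↦ F (-x)) (Ioi 0)) :
    IntegrableOn F (Iic 0) := by
  rw [integrableOn_Iic_iff_integrableOn_Iio]
  simpa using (show IntegrableOn (fun x ↦ F (-x)) (Ioi (-0)) by simpa using h).comp_neg_Iio

theorem integral_eq_add_setIntegral_Ioi {F : ℝ → ℝ} (hl : IntegrableOn (fun x ↦ F (-x)) (Ioi 0))
    (hr : IntegrableOn F (Ioi 0)) :
    ∫ x, F x = (∫ x in Ioi 0, F (-x)) + ∫ x in Ioi 0, F x := by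
  rw [integral_comp_neg_Ioi, neg_zero]
  exact (intervalIntegral.integral_Iic_add_Ioi (integrableOn_Iic_of_comp_neg hl) hr).symm

namespace HasProfiles

variable {u : Lp ℂ 2 (volume : Measure ℝ)} {ρl γl ρr γr : ℝ → ℝ}

theorem derivNormSq_eq (h : HasProfiles u ρl γl ρr γr) :
    derivNormSq u = (∫ x in Ioi 0, γl x ^ 2) + ∫ x in Ioi 0, γr x ^ 2 := by
  rw [derivNormSq, setIntegral_Iio_eq]
  congr 1
  · refine integral_congr_ae ?_
    filter_upwards [h.norm_deriv_left] with x hx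
    rw [hx]
  · refine integral_congr_ae ?_
    filter_upwards [h.norm_deriv_right] with x hx
    rw [hx]

theorem integral_comp_norm (h : HasProfiles u ρl γl ρr γr) (F : ℝ → ℝ)
    (hl : IntegrableOn (fun x ↦ F (ρl x)) (Ioi 0)) (hr : IntegrableOn (fun x ↦ F (ρr x)) (Ioi 0)) :
    ∫ x, F ‖u x‖ = (∫ x in Ioi 0, F (ρl x)) + ∫ x in Ioi 0, F (ρr x) := by
  have e1 : (fun x ↦ F (ρl x)) =ᵐ[volume.restrict (Ioi 0)] fun x ↦ F ‖u (-x)‖ := by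
    filter_upwards [h.norm_left] with x hx
    rw [hx]
  have e2 : (fun x ↦ F (ρr x)) =ᵐ[volume.restrict (Ioi 0)] fun x ↦ F ‖u x‖ := by
    filter_upwards [h.norm_right] with x hx
    rw [hx]
  rw [integral_eq_add_setIntegral_Ioi (hl.congr_fun_ae e1) (hr.congr_fun_ae e2),
    integral_congr_ae e1, integral_congr_ae e2]

theorem powerNorm_eq (h : HasProfiles u ρl γl ρr γr) {μ : ℝ} (hμ : 0 < μ) :
    powerNorm (2 * μ + 2) u
      = (∫ x in Ioi 0, ρl x ^ (2 * μ + 2)) + ∫ x in Ioi 0, ρr x ^ (2 * μ + 2) :=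
  h.integral_comp_norm (fun r ↦ r ^ (2 * μ + 2)) (h.left.integrableOn_rpow hμ)
    (h.right.integrableOn_rpow hμ)

theorem norm_sq_eq (h : HasProfiles u ρl γl ρr γr) :
    ‖u‖ ^ 2 = (∫ x in Ioi 0, ρl x ^ 2) + ∫ x in Ioi 0, ρr x ^ 2 := by
  rw [← h.integral_comp_norm (fun r ↦ r ^ 2) h.left.integrableOn_sq h.right.integrableOn_sq]
  have := L2.inner_def (𝕜 := ℂ) u u
  have h2 : ‖u‖ ^ 2 = RCLike.re (inner ℂ u u) := (inner_self_eq_norm_sq (𝕜 := ℂ) u).symm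
  rw [h2, this, ← integral_re (L2.integrable_inner u u)]
  simp only [inner_self_eq_norm_sq]

theorem nehari_eq (h : HasProfiles u ρl γl ρr γr) (v : ℝ) {μ : ℝ} (hμ : 0 < μ) (ω : ℝ) :
    nehari v μ ω u = profileNehari μ ω ρl γl + profileNehari μ ω ρr γr - v * ρl 0 ^ 2 := by
  rw [nehari, h.derivNormSq_eq, h.powerNorm_eq hμ, h.norm_sq_eq, h.norm_leftTrace, profileNehari,
    profileNehari]
  ring

theorem action_eq (h : HasProfiles u ρl γl ρr γr) (v : ℝ) {μ : ℝ} (hμ : 0 < μ) (ω : ℝ) :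
    action v μ ω u = profileAction μ ω ρl γl + profileAction μ ω ρr γr - v / 2 * ρl 0 ^ 2 := by
  rw [action, energy, h.derivNormSq_eq, h.powerNorm_eq hμ, h.norm_sq_eq, h.norm_leftTrace,
    profileAction, profileAction]
  ring

theorem exists_ne_zero (h : HasProfiles u ρl γl ρr γr) (hu : u ≠ 0) :
    ∃ x, 0 ≤ x ∧ (ρl x ≠ 0 ∨ ρr x ≠ 0) := by
  by_contra! hz
  have e := h.norm_sq_eq
  rw [setIntegral_eq_zero_of_forall_eq_zero fun x hx ↦ by rw [(hz x (le_of_lt hx)).1]; simp,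
    setIntegral_eq_zero_of_forall_eq_zero fun x hx ↦ by rw [(hz x (le_of_lt hx)).2]; simp,
    add_zero] at e
  exact hu (norm_eq_zero.1 (pow_eq_zero_iff two_ne_zero |>.1 e))

end HasProfiles

theorem memH1_of_hasDerivAt {f : ℝ → ℂ} {F F' : ℝ → ℝ} (hF : ∀ x, HasDerivAt F (F' x) x)
    (hF' : Continuous F') (hp : IsProfile F fun x ↦ |F' x|) (σ : ℂ)
    (hf : ∀ᵐ x ∂volume.restrict (Ioi 0), f x = σ * F x) :
    MemH1 (Ioi 0) f ∧ weakDeriv (Ioi 0) f =ᵐ[volume.restrict (Ioi 0)] (fun x ↦ σ * F' x) ∧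
      HasBoundaryValue (Ioi 0) f 0 (σ * F 0) := by
  have hg : MemLp (fun x ↦ σ * (F' x : ℂ)) 2 (volume.restrict (Ioi 0)) := by
    refine MemLp.const_mul ?_ σ
    refine hp.memLp_slope.mono (Complex.continuous_ofReal.comp hF').aestronglyMeasurable
      (Eventually.of_forall fun x ↦ ?_)
    simp
  have hprim : ∀ x, σ * (F x : ℂ) = σ * F 0 + ∫ t in (0 : ℝ)..x, σ * (F' t : ℂ) := by
    intro x
    rw [intervalIntegral.integral_const_mul, intervalIntegral.integral_ofReal,
      intervalIntegral.integral_eq_sub_of_hasDerivAt (fun t _ ↦ hF t)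
        (hF'.intervalIntegrable _ _)]
    push_cast
    ring
  have hFc : Continuous F := continuous_iff_continuousAt.2 fun x ↦ (hF x).continuousAt
  have hw : HasWeakDerivOn (Ioi 0) f (fun x ↦ σ * (F' x : ℂ)) := by
    refine (hasWeakDerivOn_primitive hg (σ * F 0)).congr isOpen_Ioi ?_
    filter_upwards [hf] with x hx
    rw [hx, hprim x]
  refine ⟨⟨?_, _, hg, hw⟩, weakDeriv_ae_eq isOpen_Ioi hw,
    fun x ↦ σ * (F x : ℂ), ?_, ?_, rfl⟩
  · have : MemLp (fun x ↦ σ * (F x : ℂ)) 2 (volume.restrict (Ioi 0)) :=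
      (hp.memLp.ofReal (K := ℂ)).const_mul σ
    exact this.ae_eq (by filter_upwards [hf] with x hx using hx.symm)
  · exact (continuous_const.mul (Complex.continuous_ofReal.comp hFc)).continuousOn
  · filter_upwards [hf] with x hx using hx.symm

theorem exists_mem_H1tau {τ : ℝ} {Fl Fl' Fr Fr' : ℝ → ℝ}
    (hFl : ∀ x, HasDerivAt Fl (Fl' x) x) (hFl' : Continuous Fl')
    (hpl : IsProfile Fl fun x ↦ |Fl' x|)
    (hFr : ∀ x, HasDerivAt Fr (Fr' x) x) (hFr' : Continuous Fr')
    (hpr : IsProfile Fr fun x ↦ |Fr' x|)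
    (hτ : τ ≠ 0) (h0 : Fr 0 = |τ| * Fl 0) :
    ∃ u ∈ H1tau τ, HasProfiles u Fl (fun x ↦ |Fl' x|) Fr (fun x ↦ |Fr' x|) := by
  set σ : ℝ := (SignType.sign τ : ℝ) with hσ
  have hσ1 : ‖(σ : ℂ)‖ = 1 := by
    rcases lt_or_gt_of_ne hτ with h | h
    · simp [hσ, sign_neg h]
    · simp [hσ, sign_pos h]
  have hlc : Continuous Fl := continuous_iff_continuousAt.2 fun x ↦ (hFl x).continuousAt
  have hrc : Continuous Fr := continuous_iff_continuousAt.2 fun x ↦ (hFr x).continuousAt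
  -- The sign of `τ` on the right upgrades the relation between moduli to the trace condition
  -- without changing the profiles.
  set U : ℝ → ℂ := fun x ↦ if x < 0 then (Fl (-x) : ℂ) else σ * (Fr x : ℂ) with hU
  have hUm : Measurable U := by
    refine Measurable.ite measurableSet_Iio ?_ ?_
    · exact (Complex.continuous_ofReal.comp (hlc.comp continuous_neg)).measurable
    · exact (continuous_const.mul (Complex.continuous_ofReal.comp hrc)).measurable
  have hUr : ∀ x ∈ Ioi (0 : ℝ), U x = σ * (Fr x : ℂ) := fun x hx ↦ if_neg (not_lt.2 (le_of_lt hx))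
  have hUl : ∀ x ∈ Ioi (0 : ℝ), U (-x) = 1 * (Fl x : ℂ) := fun x hx ↦ by
    simp only [hU]
    rw [if_pos (by simpa using hx), neg_neg, one_mul]
  have hUL : MemLp U 2 volume := by
    rw [memLp_two_iff_integrable_sq_norm hUm.aestronglyMeasurable]
    have hr : IntegrableOn (fun x ↦ ‖U x‖ ^ 2) (Ioi 0) := by
      refine hpr.integrableOn_sq.congr_fun (fun x hx ↦ ?_) measurableSet_Ioi
      simp only []
      rw [hUr x hx, norm_mul, hσ1, one_mul, Complex.norm_real, Real.norm_eq_abs, sq_abs]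
    have hl : IntegrableOn (fun x ↦ ‖U (-x)‖ ^ 2) (Ioi 0) := by
      refine hpl.integrableOn_sq.congr_fun (fun x hx ↦ ?_) measurableSet_Ioi
      simp only []
      rw [hUl x hx, one_mul, Complex.norm_real, Real.norm_eq_abs, sq_abs]
    have := (integrableOn_Iic_of_comp_neg (F := fun x ↦ ‖U x‖ ^ 2) hl).union hr
    rwa [Iic_union_Ioi, integrableOn_univ] at this
  have hae := hUL.coeFn_toLp
  set u := hUL.toLp U
  have hr : ∀ᵐ x ∂volume.restrict (Ioi 0), u x = σ * (Fr x : ℂ) := by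
    filter_upwards [ae_restrict_of_ae hae, ae_restrict_mem measurableSet_Ioi] with x h1 h2
    rw [h1, hUr x h2]
  have hl : ∀ᵐ x ∂volume.restrict (Ioi 0), u (-x) = 1 * (Fl x : ℂ) := by
    have := (Measure.measurePreserving_neg (volume : Measure ℝ)).quasiMeasurePreserving.ae_eq hae
    filter_upwards [ae_restrict_of_ae this, ae_restrict_mem measurableSet_Ioi] with x h1 h2
    rw [← hUl x h2]
    exact h1
  obtain ⟨r1, r2, r3⟩ := memH1_of_hasDerivAt hFr hFr' hpr σ hr
  obtain ⟨l1, l2, l3⟩ := memH1_of_hasDerivAt (f := fun x ↦ u (-x)) hFl hFl' hpl 1 hl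
  have hpre : Neg.neg ⁻¹' (Iio (0 : ℝ)) = Ioi 0 := by simp
  have hpre' : Neg.neg ⁻¹' (Ioi (0 : ℝ)) = Iio 0 := by simp
  have l4 := l1.comp_neg isOpen_Ioi
  have l5 := l3.comp_neg isOpen_Ioi
  rw [hpre'] at l4 l5
  simp only [neg_neg, neg_zero] at l4 l5
  have l6 := weakDeriv_comp_neg isOpen_Iio l4
  rw [hpre] at l6
  have tl : leftTrace u = 1 * Fl 0 := boundaryValue_eq isOpen_Iio (by simp) l5
  have tr : rightTrace u = σ * Fr 0 := boundaryValue_eq isOpen_Ioi (by simp) r3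
  refine ⟨u, ⟨l4, r1, ?_⟩, hpl, hpr, ?_, ?_, ?_, ?_, ?_, ?_⟩
  · rw [tl, tr, h0, one_mul]
    have : σ * |τ| = τ := sign_mul_abs τ
    conv_rhs => rw [← this]
    push_cast
    ring
  · filter_upwards [hl] with x hx
    rw [hx, one_mul, Complex.norm_real, Real.norm_of_nonneg (hpl.nonneg x)]
  · filter_upwards [hr] with x hx
    rw [hx, norm_mul, hσ1, one_mul, Complex.norm_real, Real.norm_of_nonneg (hpr.nonneg x)]
  · filter_upwards [l6, l2] with x h1 h2
    rw [← norm_neg, ← h1, h2, one_mul, Complex.norm_real, Real.norm_eq_abs]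
  · filter_upwards [r2] with x hx
    rw [hx, norm_mul, hσ1, one_mul, Complex.norm_real, Real.norm_eq_abs]
  · rw [tl, one_mul, Complex.norm_real, Real.norm_of_nonneg (hpl.nonneg 0)]
  · rw [tr, norm_mul, hσ1, one_mul, Complex.norm_real, Real.norm_of_nonneg (hpr.nonneg 0)]

theorem HasProfiles.ne_zero {u : Lp ℂ 2 (volume : Measure ℝ)} {ρl γl ρr γr : ℝ → ℝ}
    (h : HasProfiles u ρl γl ρr γr) (hpos : ∀ x, 0 < ρr x) : u ≠ 0 := by
  rintro rfl
  have hz : ∀ᵐ x ∂volume.restrict (Ioi (0 : ℝ)), False := by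
    filter_upwards [h.norm_right, ae_restrict_of_ae (Lp.coeFn_zero ℂ 2 volume)] with x h1 h2
    rw [h2] at h1
    exact (hpos x).ne (by simpa using h1)
  rw [eventually_false_iff_eq_bot, ae_eq_bot, Measure.restrict_eq_zero] at hz
  simp at hz

theorem HasProfiles.right_zero_eq {u : Lp ℂ 2 (volume : Measure ℝ)} {ρl γl ρr γr : ℝ → ℝ}
    (h : HasProfiles u ρl γl ρr γr) {τ : ℝ} (hu : u ∈ H1tau τ) : ρr 0 = |τ| * ρl 0 := by
  rw [← h.norm_rightTrace, ← h.norm_leftTrace, hu.2.2, norm_mul, Complex.norm_real,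
    Real.norm_eq_abs]

theorem exists_soliton_state (μ ω : ℝ) (hμ : 0 < μ) (hω : 0 < ω) {τ : ℝ} (hτ : τ ≠ 0) {a b : ℝ}
    (h0 : soliton μ ω b = |τ| * soliton μ ω a) :
    ∃ u ∈ H1tau τ, u ≠ 0 ∧ HasProfiles u
      (fun x ↦ soliton μ ω (x + a)) (fun x ↦ |solitonDeriv μ ω (x + a)|)
      (fun x ↦ soliton μ ω (x + b)) (fun x ↦ |solitonDeriv μ ω (x + b)|) := by
  have hs := continuous_solitonDeriv (ω := ω) hμ
  obtain ⟨u, hu, hp⟩ := exists_mem_H1tau (τ := τ)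
    (fun x ↦ hasDerivAt_soliton_add hμ a x) (by fun_prop) (isProfile_soliton hμ hω a)
    (fun x ↦ hasDerivAt_soliton_add hμ b x) (by fun_prop) (isProfile_soliton hμ hω b) hτ
    (by simpa using h0)
  exact ⟨u, hu, hp.ne_zero fun x ↦ soliton_pos hμ hω _, hp⟩

/-! ### The minimizer on the Nehari manifold. -/

/-- For `ω > v² / (τ² + 1)²` the action attains its minimum on the Nehari manifold. -/
theorem exists_isMinOn_action {τ v μ ω : ℝ} (hτ₀ : τ ≠ 0) (hv : 0 < v) (hμ : 0 < μ)
    (hω : v ^ 2 / (τ ^ 2 + 1) ^ 2 < ω) :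
    ∃ u ∈ nehariManifold τ v μ ω, IsMinOn (action v μ ω) (nehariManifold τ v μ ω) u := by
  have hω0 : 0 < ω := lt_of_le_of_lt (by positivity) hω
  have hτa : 0 < |τ| := abs_pos.2 hτ₀
  have hτ2 : 0 < τ ^ 2 := by positivity
  have hvω : v < (1 + τ ^ 2) * √ω := by
    have h1 : v / (τ ^ 2 + 1) < √ω := by
      rw [Real.lt_sqrt (by positivity), div_pow]
      exact hω
    rw [div_lt_iff₀ (by positivity)] at h1
    linarith
  rcases le_total |τ| 1 with h1 | h1
  · obtain ⟨a, b, hab, hN, hmin⟩ := exists_optimal_solitons hμ hω0 hτa h1 hv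
      (by rwa [sq_abs])
    obtain ⟨u, hu, hu0, hp⟩ := exists_soliton_state μ ω hμ hω0 hτ₀ hab
    refine ⟨u, ⟨hu, hu0, ?_⟩, fun w hw ↦ ?_⟩
    · rw [hp.nehari_eq v hμ ω]
      simpa only [zero_add] using hN
    · obtain ⟨hw1, hw0, hwN⟩ := hw
      obtain ⟨ρl, γl, ρr, γr, hq⟩ := exists_hasProfiles hw1.1 hw1.2.1
      rw [hq.nehari_eq v hμ ω] at hwN
      have := hmin ρl γl ρr γr hq.left hq.right (hq.right_zero_eq hw1) (hq.exists_ne_zero hw0) hwN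
      change action v μ ω u ≤ action v μ ω w
      rw [hp.action_eq v hμ ω, hq.action_eq v hμ ω]
      simpa only [zero_add] using this
  · have hκ : 0 < |τ|⁻¹ := inv_pos.2 hτa
    have hκ2 : |τ|⁻¹ ^ 2 = (τ ^ 2)⁻¹ := by rw [inv_pow, sq_abs]
    -- For `|τ| ≥ 1` the half-lines are exchanged: the right trace is the larger one, the ratio is
    -- `1/|τ|`, and `v |u(0-)|² = (v/τ²) |u(0+)|²` gives `q`. Multiplied by `τ²`, the bound on `q`
    -- is the same threshold.
    obtain ⟨a, b, hab, hN, hmin⟩ := exists_optimal_solitons (q := v / τ ^ 2) hμ hω0 hκ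
      (inv_le_one_of_one_le₀ h1) (by positivity) (by
        rw [hκ2, div_lt_iff₀ hτ2]
        have : (1 + (τ ^ 2)⁻¹) * √ω * τ ^ 2 = (1 + τ ^ 2) * √ω := by
          field_simp
          ring
        rwa [this])
    have hba : soliton μ ω a = |τ| * soliton μ ω b := by
      rw [hab, mul_inv_cancel_left₀ hτa.ne']
    obtain ⟨u, hu, hu0, hp⟩ := exists_soliton_state μ ω hμ hω0 hτ₀ hba
    have hsq : ∀ r s : ℝ, r = |τ| * s → v / τ ^ 2 * r ^ 2 = v * s ^ 2 := by
      rintro r s rfl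
      rw [mul_pow, sq_abs]
      field_simp
    refine ⟨u, ⟨hu, hu0, ?_⟩, fun w hw ↦ ?_⟩
    · rw [hp.nehari_eq v hμ ω]
      rw [hsq _ _ hba] at hN
      simp only [zero_add]
      linarith
    · obtain ⟨hw1, hw0, hwN⟩ := hw
      obtain ⟨ρl, γl, ρr, γr, hq⟩ := exists_hasProfiles hw1.1 hw1.2.1
      have e0 := hq.right_zero_eq hw1
      rw [hq.nehari_eq v hμ ω] at hwN
      obtain ⟨x, hx, hx0⟩ := hq.exists_ne_zero hw0
      have := hmin ρr γr ρl γl hq.right hq.left (by rw [e0, inv_mul_cancel_left₀ hτa.ne'])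
        ⟨x, hx, hx0.symm⟩ (by rw [hsq _ _ e0]; linarith)
      change action v μ ω u ≤ action v μ ω w
      rw [hp.action_eq v hμ ω, hq.action_eq v hμ ω]
      have f1 := hsq _ _ e0
      have f2 := hsq _ _ hba
      simp only [zero_add]
      linarith

end FulopTsutsui

end

theorem mainTheorem1 (τ v μ ω : ℝ) (hτ₀ : τ ≠ 0) (hτ₁ : τ ≠ 1) (hτ₂ : τ ≠ -1)
    (hv : 0 < v) (hμ : 0 < μ) (hω : v ^ 2 / (τ ^ 2 + 1) ^ 2 < ω) :
    ∃ u ∈ FulopTsutsui.nehariManifold τ v μ ω,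
      IsMinOn (FulopTsutsui.action v μ ω) (FulopTsutsui.nehariManifold τ v μ ω) u :=
  FulopTsutsui.exists_isMinOn_action hτ₀ hv hμ hω
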